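/- All spaces are over $\mathbb C$. Let $n\ge 1$ and let $V=\mathbb C^{n|n}$ be the superspace with even basis $e_1,\dots,e_n$ and odd basis $f_1,\dots,f_n$. Let $\mathfrak{pe}(n)\subset\mathfrak{gl}(n|n)$ be the periplectic Lie superalgebra preserving the odd supersymmetric form $P(e_i,f_j)=P(f_j,e_i)=\delta_{ij}$, that is, the matrices $\begin{pmatrix}A&B\\ C&-A^t\end{pmatrix}$ with $B^t=B$, $C^t=-C$. Let $\mathfrak{spe}(n)=\mathfrak{pe}(n)\cap\mathfrak{sl}(n|n)$ be the subalgebra of elements of supertrace $0$. Put $z=1_{2n}$, $\tau=\mathrm{diag}(1_n,-1_n)$, $\mathfrak{cpe}(n)=\mathfrak{pe}(n)\oplus\langle z\rangle$ and $\mathfrak{cspe}(n)=\mathfrak{spe}(n)\oplus\langle z\rangle$. For a Lie superalgebra $\mathfrak g_0\subset\mathfrak{gl}(V)$ put $\mathfrak g_{-1}=V$ and, for $i>0$, $$\mathfrak g_i=\{X\in\mathrm{Hom}(\mathfrak g_{-1},\mathfrak g_{i-1}) : X(v)(w)=(-1)^{p(v)p(w)}X(w)(v)\ \text{for all homogeneous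 } v,w\in V\}.$$ The Cartan prolongation of $(V,\mathfrak g_0)$ is $\mathfrak g_*(V,\mathfrak g_0)=\bigoplus_{i\ge-1}\mathfrak g_i$, with the Lie superbracket of vector fields, which is determined by $[v,w]=0$ and $[X,v]=X(v)$ for $v,w\in V$ and $X\in\mathfrak g_i$ with $i\ge0$, super-antisymmetry, and $[X,Y](v)=[X,Y(v)]+(-1)^{p(Y)p(v)}[X(v),Y]$ for homogeneous $X, Y$ of degree $\ge 0$ and homogeneous $v\in V$. a) If $\mathfrak g_0$ is $\mathfrak{spe}(n)$, $\mathfrak{pe}(n)$, $\mathfrak{cspe}(n)$, or $\mathfrak{spe}(n)\oplus\langle a\tau+bz\rangle$ with $a,b\in\mathbb C\setminus\{0\}$ and $b/a\ne n$, then $\mathfrak g_i=0$ for all $i\ge1$, that is, $\mathfrak g_*(V,\mathfrak g_0)=\mathfrak g_{-1}\oplus\mathfrak g_0$. b) Let $n\ge2$. Then $\mathfrak g_*(V,\mathfrak{cpe}(n))\cong\mathfrak{pe}(n+1)$ and $\mathfrak g_*(V,\mathfrak{spe}(n)\oplus\langle\tau+nz\rangle)\cong\mathfrak{spe}(n+1)$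 as $\mathbb Z$-graded Lie superalgebras. Here $\mathfrak{pe}(n+1)$ and $\mathfrak{spe}(n+1)$ carry the $\mathbb Z$-grading $\mathfrak g_{-1}\oplus\mathfrak g_0\oplus\mathfrak g_1\oplus\mathfrak g_2$ of depth $1$ obtained by giving $e_{n+1}$ weight $1$, $f_{n+1}$ weight $-1$ and all the other basis vectors of $\mathbb C^{n+1|n+1}$ weight $0$: an operator has degree $d$ if it raises weights by $d$. The isomorphisms can be chosen to be, in degree $-1$, the standard identification with $V=\langle e_1,\dots,e_n,f_1,\dots,f_n\rangle$ given by $x\mapsto x\,e_{n+1}$. -/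

import Mathlib

open Matrix

noncomputable section

namespace Periplectic

/-! ### Cartan prolongation of a pair `(V, g₀)`, `g₀ ⊆ gl(V)`, for a superspace `V` -/

/-- The sign `(-1)^{p q}` of the rule of signs. -/
def koszul (p q : ZMod 2) : ℂ := (-1) ^ (p.val * q.val)

section Prolongation

universe u

/-- Iterated `Hom`-spaces bundled with their vector space structure:
`T₀ = V` and `T_{k+1} = Hom(V, T_k)`. -/
def towerAux (V : Type u) [AddCommGroup V] [Module ℂ V] :
    ℕ → Σ (T : Type u) (_ : AddCommGroup T), Module ℂ T
  | 0 => ⟨V, inferInstance, inferInstance⟩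
  | k + 1 =>
    letI := (towerAux V k).2.1
    letI := (towerAux V k).2.2
    ⟨V →ₗ[ℂ] (towerAux V k).1, inferInstance, inferInstance⟩

/-- `Tower V 0 = V`, `Tower V (k+1) = Hom(V, Tower V k)`; the component of degree `k - 1` of a
(formal) vector field on `V` lives in `Tower V k`. -/
def Tower (V : Type u) [AddCommGroup V] [Module ℂ V] (k : ℕ) : Type u := (towerAux V k).1

variable {V : Type u} [AddCommGroup V] [Module ℂ V]

instance (k : ℕ) : AddCommGroup (Tower V k) := (towerAux V k).2.1

instance (k : ℕ) : Module ℂ (Tower V k) := (towerAux V k).2.2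

/-- `Tower V 0` is `V`. -/
def towerZero : Tower V 0 ≃ₗ[ℂ] V := LinearEquiv.refl ℂ V

/-- `Tower V (k+1)` is `Hom(V, Tower V k)`. -/
def towerSucc (k : ℕ) : Tower V (k + 1) ≃ₗ[ℂ] (V →ₗ[ℂ] Tower V k) :=
  LinearEquiv.refl ℂ (V →ₗ[ℂ] Tower V k)

/-- `Tower V 1` is `End V = gl(V)`. -/
def towerOne : Tower V 1 ≃ₗ[ℂ] Module.End ℂ V := LinearEquiv.refl ℂ (Module.End ℂ V)

/-- The `ℤ/2`-grading (parity) of the iterated `Hom`-spaces: `X ∈ Hom(V, T)` has parity `p` if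
it maps vectors of parity `q` to elements of parity `p + q`. -/
def towerParity (𝒱 : ZMod 2 → Submodule ℂ V) : (k : ℕ) → ZMod 2 → Submodule ℂ (Tower V k)
  | 0, p => (𝒱 p).comap (towerZero (V := V)).toLinearMap
  | k + 1, p =>
    { carrier := {X | ∀ q, ∀ v ∈ 𝒱 q, towerSucc k X v ∈ towerParity 𝒱 k (p + q)}
      add_mem' := by
        intro X Y hX hY q v hv
        simpa using add_mem (hX q v hv) (hY q v hv)
      zero_mem' := by
        intro q v _
        simp
      smul_mem' := by
        intro c X hX q v hv
        simpa using Submodule.smul_mem _ c (hX q v hv) }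

/-- The terms of the Cartan prolongation; `cartanTerm 𝒱 g₀ k` is the term `g_{k-1}`:
`g_{-1} = V`, then `g_0`, and for `i > 0`
`g_i = {X ∈ Hom(g_{-1}, g_{i-1}) | X(v)(w) = (-1)^{p(v)p(w)} X(w)(v)}`
for all homogeneous `v, w` in `V`. -/
def cartanTerm (𝒱 : ZMod 2 → Submodule ℂ V) (g₀ : Submodule ℂ (Module.End ℂ V)) :
    (k : ℕ) → Submodule ℂ (Tower V k)
  | 0 => ⊤
  | 1 => g₀.comap (towerOne (V := V)).toLinearMap
  | k + 2 =>
    { carrier := {X | (∀ v, towerSucc (k + 1) X v ∈ cartanTerm 𝒱 g₀ (k + 1)) ∧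
        ∀ p q, ∀ v ∈ 𝒱 p, ∀ w ∈ 𝒱 q,
          towerSucc k (towerSucc (k + 1) X v) w =
            koszul p q • towerSucc k (towerSucc (k + 1) X w) v}
      add_mem' := by
        rintro X Y ⟨hX, hX'⟩ ⟨hY, hY'⟩
        refine ⟨fun v => ?_, fun p q v hv w hw => ?_⟩
        · simpa using add_mem (hX v) (hY v)
        · simp [hX' p q v hv w hw, hY' p q v hv w hw]
      zero_mem' := by
        refine ⟨fun v => ?_, fun p q v hv w hw => ?_⟩ <;> simp
      smul_mem' := by
        rintro c X ⟨hX, hX'⟩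
        refine ⟨fun v => ?_, fun p q v hv w hw => ?_⟩
        · simpa using Submodule.smul_mem _ c (hX v)
        · simp [hX' p q v hv w hw, smul_comm c] }

/-- Families `(X_k)` with `X_k` of degree `k - 1`. -/
abbrev Fields (V : Type u) [AddCommGroup V] [Module ℂ V] : Type u := (k : ℕ) → Tower V k

/-- The Cartan prolongation `g_*(V, g₀) = ⨁_{i ≥ -1} g_i`: the families `(X_k)` with
`X_k ∈ g_{k-1}` and only finitely many `X_k` nonzero. -/
def cartanProlongation (𝒱 : ZMod 2 → Submodule ℂ V) (g₀ : Submodule ℂ (Module.End ℂ V)) :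
    Submodule ℂ (Fields V) where
  carrier := {X | (∀ k, X k ∈ cartanTerm 𝒱 g₀ k) ∧ ∃ N, ∀ k, N ≤ k → X k = 0}
  add_mem' := by
    rintro X Y ⟨hX, N, hN⟩ ⟨hY, M, hM⟩
    refine ⟨fun k => add_mem (hX k) (hY k), max N M, fun k hk => ?_⟩
    simp [hN k (le_trans (le_max_left _ _) hk), hM k (le_trans (le_max_right _ _) hk)]
  zero_mem' := ⟨fun k => zero_mem _, 0, fun _ _ => rfl⟩
  smul_mem' := by
    rintro c X ⟨hX, N, hN⟩
    refine ⟨fun k => Submodule.smul_mem _ c (hX k), N, fun k hk => ?_⟩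
    simp [hN k hk]

/-- `evalAt X v` is the family `X(v)`: `(X(v))_k = X_{k+1}(v)`. This is `[X, v]` for
`v ∈ V = g_{-1}`. -/
def evalAt : Fields V →ₗ[ℂ] V →ₗ[ℂ] Fields V :=
  LinearMap.mk₂ ℂ (fun X v k => towerSucc k (X (k + 1)) v)
    (fun X Y v => by ext k; simp) (fun c X v => by ext k; simp)
    (fun X v w => by ext k; simp) (fun c X v => by ext k; simp)

variable (𝒱 : ZMod 2 → Submodule ℂ V) [DirectSum.Decomposition 𝒱]

/-- The projection of the superspace `V` onto its component of parity `r`. -/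
def parityProj (r : ZMod 2) : V →ₗ[ℂ] V :=
  (𝒱 r).subtype ∘ₗ DirectSum.component ℂ (ZMod 2) (fun i => 𝒱 i) r ∘ₗ
    (DirectSum.decomposeLinearEquiv 𝒱).toLinearMap

/-- The `k`-th component of the Lie superbracket `[X, Y]` of `X` of parity `p` and `Y` of
parity `q`. It is the bracket of (formal) vector fields on `V`, determined by
`[X, v] = X(v)`, `[v, X] = -(-1)^{p(v)p(X)} X(v)` for `v ∈ V`, `[V, V] = 0`, and
`[X, Y](v) = [X, Y(v)] + (-1)^{p(Y)p(v)} [X(v), Y]` for homogeneous `v ∈ V`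
(the Jacobi identity with `v`). -/
def superBracketComp : ZMod 2 → ZMod 2 → (k : ℕ) →
    (Fields V →ₗ[ℂ] Fields V →ₗ[ℂ] Tower V k)
  | p, q, 0 =>
    LinearMap.mk₂ ℂ
      (fun X Y => towerSucc 0 (X 1) (towerZero (Y 0)) -
        koszul p q • towerSucc 0 (Y 1) (towerZero (X 0)))
      (fun X X' Y => by simp; abel) (fun c X Y => by simp [smul_sub, smul_comm c])
      (fun X Y Y' => by simp; abel) (fun c X Y => by simp [smul_sub, smul_comm c])
  | p, q, k + 1 =>
    LinearMap.mk₂ ℂ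
      (fun X Y => (towerSucc k).symm (∑ r : ZMod 2,
        (superBracketComp p (q + r) k X ∘ₗ evalAt Y +
          koszul q r • ((superBracketComp (p + r) q k).flip Y ∘ₗ evalAt X)) ∘ₗ
            parityProj 𝒱 r))
      (fun X X' Y => by
        rw [← map_add, ← Finset.sum_add_distrib]
        congr 1; refine Finset.sum_congr rfl fun r _ => ?_
        ext v; simp; abel)
      (fun c X Y => by
        rw [← map_smul, Finset.smul_sum]
        congr 1; refine Finset.sum_congr rfl fun r _ => ?_
        ext v; simp [smul_comm c])
      (fun X Y Y' => by
        rw [← map_add, ← Finset.sum_add_distrib]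
        congr 1; refine Finset.sum_congr rfl fun r _ => ?_
        ext v; simp; abel)
      (fun c X Y => by
        rw [← map_smul, Finset.smul_sum]
        congr 1; refine Finset.sum_congr rfl fun r _ => ?_
        ext v; simp [smul_comm c])

/-- The Lie superbracket `[X, Y]` of `X` of parity `p` and `Y` of parity `q`. -/
def superBracket (p q : ZMod 2) (X Y : Fields V) : Fields V :=
  fun k => superBracketComp 𝒱 p q k X Y

end Prolongation

/-! ### The superspace `ℂ^{n|n}` and the periplectic Lie superalgebras -/

/-- Indices of the basis `e_1, …, e_n` (even), `f_1, …, f_n` (odd) of `ℂ^{n|n}`. -/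
abbrev Idx (n : ℕ) : Type := Fin n ⊕ Fin n

/-- Matrices in the standard format `(n, n)`: the elements of `gl(n|n)`. -/
abbrev Mat (n : ℕ) : Type := Matrix (Idx n) (Idx n) ℂ

/-- Parity of the basis vectors. -/
def idxParity {n : ℕ} : Idx n → ZMod 2 := Sum.elim (fun _ => 0) (fun _ => 1)

/-- The parity components `V_0`, `V_1` of `V = ℂ^{n|n}`. -/
def stdParity (n : ℕ) (p : ZMod 2) : Submodule ℂ (Idx n → ℂ) where
  carrier := {v | ∀ i, idxParity i ≠ p → v i = 0}
  add_mem' := by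
    intro v w hv hw i hi
    simp [hv i hi, hw i hi]
  zero_mem' := fun _ _ => rfl
  smul_mem' := by
    intro c v hv i hi
    simp [hv i hi]

/-- The projection of `ℂ^{n|n}` onto its component of parity `p`. -/
def stdProj (n : ℕ) (p : ZMod 2) : (Idx n → ℂ) →ₗ[ℂ] stdParity n p where
  toFun v := ⟨fun i => if idxParity i = p then v i else 0, fun i hi => by simp [hi]⟩
  map_add' v w := by
    ext i
    by_cases h : idxParity i = p <;> simp [h]
  map_smul' c v := by
    ext i
    by_cases h : idxParity i = p <;> simp [h]

instance (n : ℕ) : DirectSum.Decomposition (stdParity n) :=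
  DirectSum.Decomposition.ofLinearMap (stdParity n)
    (∑ p : ZMod 2, DirectSum.lof ℂ (ZMod 2) (fun p => stdParity n p) p ∘ₗ stdProj n p)
    (by
      refine LinearMap.ext fun v => ?_
      ext i
      simp [stdProj])
    (by
      ext p v : 2
      simp only [LinearMap.comp_apply, LinearMap.sum_apply, LinearMap.id_apply,
        DirectSum.coeLinearMap_lof]
      rw [Finset.sum_eq_single p]
      · congr 1
        ext i
        by_cases h : idxParity i = p
        · simp [stdProj, h]
        · simp [stdProj, h, v.2 i h]
      · intro q _ hq
        have : stdProj n q v = 0 := by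
          ext i
          by_cases h : idxParity i = q
          · simp [stdProj, v.2 i (by rw [h]; exact hq)]
          · simp [stdProj, h]
        rw [this, map_zero]
      · simp)

/-- `X ∈ gl(n|n)` is homogeneous of parity `p`. -/
def HasParity {n : ℕ} (p : ZMod 2) (X : Mat n) : Prop :=
  ∀ i j, X i j ≠ 0 → idxParity i = idxParity j + p

/-- The supercommutator `[X, Y] = XY - (-1)^{pq} YX` of matrices of parities `p` and `q`. -/
def superComm {n : ℕ} (p q : ZMod 2) (X Y : Mat n) : Mat n := X * Y - koszul p q • (Y * X)

/-- The periplectic Lie superalgebra `pe(n)`: the matrices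
`diag(A, -Aᵗ) + antidiag(B, C)` with `Bᵗ = B`, `Cᵗ = -C`. -/
def pe (n : ℕ) : Submodule ℂ (Mat n) where
  carrier := {X | X.toBlocks₂₂ = -X.toBlocks₁₁ᵀ ∧ X.toBlocks₁₂ᵀ = X.toBlocks₁₂ ∧
    X.toBlocks₂₁ᵀ = -X.toBlocks₂₁}
  add_mem' := by
    rintro X Y ⟨h₁, h₂, h₃⟩ ⟨k₁, k₂, k₃⟩
    refine ⟨?_, ?_, ?_⟩
    · ext i j
      have := congrFun₂ h₁ i j; have := congrFun₂ k₁ i j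
      simp [toBlocks₁₁, toBlocks₂₂] at *; simp [*]; ring
    · ext i j
      have := congrFun₂ h₂ i j; have := congrFun₂ k₂ i j
      simp [toBlocks₁₂] at *; simp [*]
    · ext i j
      have := congrFun₂ h₃ i j; have := congrFun₂ k₃ i j
      simp [toBlocks₂₁] at *; simp [*]; ring
  zero_mem' := by
    refine ⟨?_, ?_, ?_⟩ <;> ext i j <;> simp [toBlocks₁₁, toBlocks₂₂, toBlocks₁₂, toBlocks₂₁]
  smul_mem' := by
    rintro c X ⟨h₁, h₂, h₃⟩
    refine ⟨?_, ?_, ?_⟩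
    · ext i j
      have := congrFun₂ h₁ i j
      simp [toBlocks₁₁, toBlocks₂₂] at *; simp [*]
    · ext i j
      have := congrFun₂ h₂ i j
      simp [toBlocks₁₂] at *; simp [*]
    · ext i j
      have := congrFun₂ h₃ i j
      simp [toBlocks₂₁] at *; simp [*]

/-- The odd supersymmetric form `P(e_i, f_j) = P(f_j, e_i) = δ_{ij}` on `ℂ^{n|n}`. -/
def oddForm {n : ℕ} (v w : Idx n → ℂ) : ℂ :=
  ∑ i, (v (Sum.inl i) * w (Sum.inr i) + v (Sum.inr i) * w (Sum.inl i))

/-- The homogeneous elements of `pe(n)` are those which preserve the form `P`. -/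
theorem mem_pe_iff_oddForm {n : ℕ} (p : ZMod 2) (X : Mat n) (hX : HasParity p X) :
    X ∈ pe n ↔ ∀ q, ∀ v ∈ stdParity n q, ∀ w,
      oddForm (X *ᵥ v) w + koszul p q * oddForm v (X *ᵥ w) = 0 := by
  have key : X ∈ pe n ↔ ∀ i j : Idx n, X j.swap i + koszul p (idxParity i) * X i.swap j = 0 := by
    have hX' : ∀ i j, idxParity i ≠ idxParity j + p → X i j = 0 := fun i j h =>
      not_not.1 fun h' => h (hX i j h')
    have hp : p = 0 ∨ p = 1 := (by decide : ∀ p : ZMod 2, p = 0 ∨ p = 1) p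
    have h20 : (1 : ZMod 2) + 1 = 0 := by decide
    constructor
    · rintro ⟨h₁, h₂, h₃⟩ i j
      have e₁ := fun i j => congrFun₂ h₁ i j
      have e₂ := fun i j => congrFun₂ h₂ i j
      have e₃ := fun i j => congrFun₂ h₃ i j
      simp only [toBlocks₁₁, toBlocks₁₂, toBlocks₂₁, toBlocks₂₂, Matrix.of_apply,
        Matrix.neg_apply, Matrix.transpose_apply] at e₁ e₂ e₃
      rcases hp with rfl | rfl <;> rcases i with i | i <;> rcases j with j | j <;>
        simp [idxParity, koszul, ZMod.val_one] at hX' ⊢ <;>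
        simp [e₁, hX'.1, hX'.2, e₂ i j, e₃ i j]
    · intro h
      refine ⟨?_, ?_, ?_⟩ <;> ext i j <;>
      simp only [toBlocks₁₁, toBlocks₁₂, toBlocks₂₁, toBlocks₂₂, Matrix.of_apply,
        Matrix.neg_apply, Matrix.transpose_apply]
      · have h1 := h (Sum.inr j) (Sum.inl i)
        rcases hp with rfl | rfl <;>
          simp [idxParity, koszul, ZMod.val_one] at hX' h1
        · linear_combination h1
        · simp [hX'.1, hX'.2]
      · have h1 := h (Sum.inr i) (Sum.inr j)
        rcases hp with rfl | rfl <;>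
          simp [idxParity, koszul, ZMod.val_one] at hX' h1
        · simp [hX'.1, hX'.2]
        · linear_combination h1
      · have h1 := h (Sum.inl i) (Sum.inl j)
        rcases hp with rfl | rfl <;>
          simp [idxParity, koszul, ZMod.val_one] at hX' h1
        · simp [hX'.1, hX'.2]
        · linear_combination h1
  have expand : ∀ q, ∀ v w : Idx n → ℂ,
      oddForm (X *ᵥ v) w + koszul p q * oddForm v (X *ᵥ w) =
        ∑ i, ∑ j, v i * w j * (X j.swap i + koszul p q * X i.swap j) := by
    intro q v w
    have form : ∀ v w : Idx n → ℂ, oddForm v w = ∑ i, v i * w i.swap := by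
      intro v w
      simp [oddForm, Fintype.sum_sum_type, Finset.sum_add_distrib]
    have h1 : oddForm (X *ᵥ v) w = ∑ i, ∑ j, v i * w j * X j.swap i := by
      rw [form, ← Equiv.sum_comp (Equiv.sumComm (Fin n) (Fin n)), Finset.sum_comm]
      refine Finset.sum_congr rfl fun i _ => ?_
      simp only [Matrix.mulVec, dotProduct, Equiv.sumComm_apply, Sum.swap_swap, Finset.sum_mul]
      exact Finset.sum_congr rfl fun j _ => by ring
    have h2 : oddForm v (X *ᵥ w) = ∑ i, ∑ j, v i * w j * X i.swap j := by
      rw [form]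
      refine Finset.sum_congr rfl fun i _ => ?_
      simp only [Matrix.mulVec, dotProduct, Finset.mul_sum]
      exact Finset.sum_congr rfl fun j _ => by ring
    rw [h1, h2, Finset.mul_sum, ← Finset.sum_add_distrib]
    refine Finset.sum_congr rfl fun i _ => ?_
    rw [Finset.mul_sum, ← Finset.sum_add_distrib]
    exact Finset.sum_congr rfl fun j _ => by ring
  rw [key]
  constructor
  · intro h q v hv w
    rw [expand]
    refine Finset.sum_eq_zero fun i _ => Finset.sum_eq_zero fun j _ => ?_
    by_cases hi : idxParity i = q
    · rw [← hi, h i j, mul_zero]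
    · simp [hv i hi]
  · intro h i j
    have := h (idxParity i) (Pi.single i 1) (fun k hk => by
      rw [Pi.single_apply, if_neg]; rintro rfl; exact hk rfl) (Pi.single j 1)
    rw [expand] at this
    simpa [Pi.single_apply] using this

/-- The supertrace. -/
def str {n : ℕ} (X : Mat n) : ℂ := X.toBlocks₁₁.trace - X.toBlocks₂₂.trace

/-- The special periplectic Lie superalgebra `spe(n) = pe(n) ∩ sl(n|n)`. -/
def spe (n : ℕ) : Submodule ℂ (Mat n) where
  carrier := {X | X ∈ pe n ∧ str X = 0}
  add_mem' := by
    rintro X Y ⟨h, h'⟩ ⟨k, k'⟩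
    refine ⟨add_mem h k, ?_⟩
    have : str (X + Y) = str X + str Y := by
      simp [str, Matrix.trace, toBlocks₁₁, toBlocks₂₂, Finset.sum_add_distrib]; ring
    simp [this, h', k']
  zero_mem' := ⟨zero_mem _, by simp [str, Matrix.trace, toBlocks₁₁, toBlocks₂₂]⟩
  smul_mem' := by
    rintro c X ⟨h, h'⟩
    refine ⟨Submodule.smul_mem _ c h, ?_⟩
    have : str (c • X) = c * str X := by
      simp [str, Matrix.trace, toBlocks₁₁, toBlocks₂₂, Finset.mul_sum, mul_sub]
    simp [this, h']

/-- `τ = diag(1_n, -1_n)`. -/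
def tau (n : ℕ) : Mat n := Matrix.fromBlocks 1 0 0 (-1)

/-- `z = 1_{2n}`. -/
def zed (n : ℕ) : Mat n := 1

/-- `cpe(n) = pe(n) ⊕ ⟨z⟩`. -/
def cpe (n : ℕ) : Submodule ℂ (Mat n) := pe n ⊔ Submodule.span ℂ {zed n}

/-- `cspe(n) = spe(n) ⊕ ⟨z⟩`. -/
def cspe (n : ℕ) : Submodule ℂ (Mat n) := spe n ⊔ Submodule.span ℂ {zed n}

/-- `spe(n) ⊕ ⟨aτ + bz⟩`. -/
def speExt (n : ℕ) (a b : ℂ) : Submodule ℂ (Mat n) :=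
  spe n ⊔ Submodule.span ℂ {a • tau n + b • zed n}

/-- A space of matrices of format `(n, n)` as a space of operators on `V = ℂ^{n|n}`. -/
def toEnd {n : ℕ} (g : Submodule ℂ (Mat n)) : Submodule ℂ (Module.End ℂ (Idx n → ℂ)) :=
  g.map (Matrix.toLin' (R := ℂ) (m := Idx n) (n := Idx n)).toLinearMap

/-- The term of degree `k - 1` of the Cartan prolongation of `(ℂ^{n|n}, g₀)`. -/
def prolongTerm {n : ℕ} (g₀ : Submodule ℂ (Mat n)) (k : ℕ) :
    Submodule ℂ (Tower (Idx n → ℂ) k) := cartanTerm (stdParity n) (toEnd g₀) k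

/-- The Cartan prolongation `g_*(ℂ^{n|n}, g₀)`. -/
def prolong {n : ℕ} (g₀ : Submodule ℂ (Mat n)) : Submodule ℂ (Fields (Idx n → ℂ)) :=
  cartanProlongation (stdParity n) (toEnd g₀)

/-! ### The depth 1 grading of `pe(n+1)` and of `spe(n+1)` -/

/-- Weights of the basis vectors of `ℂ^{n+1|n+1}`: `e_{n+1}` has weight `1`, `f_{n+1}` has
weight `-1`, all the others have weight `0`. -/
def weight {n : ℕ} : Idx (n + 1) → ℤ :=
  Sum.elim (fun i => if i = Fin.last n then 1 else 0) (fun i => if i = Fin.last n then -1 else 0)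

/-- `X` has degree `d` for the grading in which the matrix unit `E_{ij}` has degree
`weight i - weight j`. -/
def HasDegree {n : ℕ} (d : ℤ) (X : Mat (n + 1)) : Prop :=
  ∀ i j, X i j ≠ 0 → weight i = weight j + d

/-- The embedding of indices for `ℂ^{n|n} ⊆ ℂ^{n+1|n+1}`, spanned by all basis vectors except
`e_{n+1}` and `f_{n+1}`. -/
def embIdx {n : ℕ} : Idx n → Idx (n + 1) := Sum.map Fin.castSucc Fin.castSucc

/-- `φ` is an isomorphism of `ℤ`-graded Lie superalgebras from `L ⊆ gl(n+1|n+1)`, with the above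
grading, onto `g_*(ℂ^{n|n}, g₀)`. On the component of degree `-1` it is the standard
identification with `V = ℂ^{n|n}`, `x ↦ x e_{n+1}`. -/
structure IsGradedIso {n : ℕ} (L : Submodule ℂ (Mat (n + 1))) (g₀ : Submodule ℂ (Mat n))
    (φ : L ≃ₗ[ℂ] prolong g₀) : Prop where
  parity : ∀ (p : ZMod 2) (x : L), HasParity p (x : Mat (n + 1)) →
    ∀ k, (φ x : Fields (Idx n → ℂ)) k ∈ towerParity (stdParity n) k p
  degree : ∀ (d : ℤ) (x : L), HasDegree d (x : Mat (n + 1)) →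
    ∀ k : ℕ, (k : ℤ) - 1 ≠ d → (φ x : Fields (Idx n → ℂ)) k = 0
  bracket : ∀ (p q : ZMod 2) (x y : L), HasParity p (x : Mat (n + 1)) →
    HasParity q (y : Mat (n + 1)) → ∃ h : superComm p q (x : Mat (n + 1)) y ∈ L,
      (φ ⟨superComm p q (x : Mat (n + 1)) y, h⟩ : Fields (Idx n → ℂ)) =
        superBracket (stdParity n) p q (φ x) (φ y)
  standard : ∀ (x : L) (i : Idx n), HasDegree (-1) (x : Mat (n + 1)) →
    towerZero ((φ x : Fields (Idx n → ℂ)) 0) i =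
      (x : Mat (n + 1)) (embIdx i) (Sum.inl (Fin.last n))

end Periplectic

end

open Periplectic

/-!
The prolongations are compared with `pe(n+1)` through the map `realize`, which sends a matrix `Y`
of size `(n+1|n+1)` to the formal vector field `Φ(Y)` on `V = ℂ^{n|n}` with component `Y e_{n+1}`
of degree `-1` and with `[Φ(Y), v] = Φ([Y, v])` for `v ∈ V = pe(n+1)_{-1}`. By the Jacobi identity it
respects brackets (`realize_superComm`), and its values on `pe(n+1)` satisfy the symmetry condition
in the definition of the prolongation since `V` is abelian (`sbr_sbr_lift_comm`). It is injective on
`pe(n+1)` because only zero commutes with `V` in degrees at least `0`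
(`eq_zero_of_sbr_lift_eq_zero`). In degree `0` it identifies `pe(n+1)_0` with `cpe(n)`: the element
with restriction `M` to `V` and eigenvalue `c` on `e_{n+1}` acts as `M - c`. On `spe(n+1)_0`, where
`str M = -2c`, this gives `spe(n) ⊕ ⟨τ + nz⟩`.

Everything else is a computation of the terms of the prolongation of `cpe(n)`.

* Lowering an index with the odd form, an element of the first prolongation of `pe(n)` becomes a
  tensor which is supersymmetric in one pair of its three arguments and super-antisymmetric in
  another, hence zero (`prolongTerm_pe_two`).
* For `cpe(n)`, the scalar part of the values is a linear functional on `V`, and each functional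
  comes from an element of `pe(n+1)_1`; so `pe(n+1)_1` exhausts the degree `1` term
  (`exists_realize_two`).
* An element of degree `2` gives a bilinear form on `V`. For `n ≥ 2` the symmetry condition forces
  this form to be a multiple of the odd form, which is what `pe(n+1)_2` provides
  (`exists_realize_three`), and it leaves nothing in degree `3` (`prolongTerm_cpe_four`).

The prolongations of `cspe(n)` and `spe(n) ⊕ ⟨aτ + bz⟩` sit inside that of `cpe(n)`. As
`[pe(n+1), pe(n+1)] ⊆ spe(n+1)`, the values of an element of degree `1` lie in
`spe(n) ⊕ ⟨τ + nz⟩` as well. If `b ≠ na`, the two subalgebras meet in `spe(n)`, so the case of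
`pe(n)` applies (`prolongTerm_speExt_two`).
-/

noncomputable section

namespace Periplectic

variable {n : ℕ}

/-! ### Signs -/

theorem zmod_two_cases (p : ZMod 2) : p = 0 ∨ p = 1 := by
  revert p; decide

theorem zmod_two_one_add_one : (1 : ZMod 2) + 1 = 0 := by decide

@[simp] theorem koszul_zero_left (q : ZMod 2) : koszul 0 q = 1 := by simp [koszul]

@[simp] theorem koszul_zero_right (p : ZMod 2) : koszul p 0 = 1 := by simp [koszul]

@[simp] theorem koszul_one_one : koszul 1 1 = -1 := by simp [koszul, ZMod.val_one]

theorem koszul_comm (p q : ZMod 2) : koszul p q = koszul q p := by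
  simp [koszul, mul_comm]

@[simp] theorem koszul_mul_self (p q : ZMod 2) : koszul p q * koszul p q = 1 := by
  rcases zmod_two_cases p with rfl | rfl <;> rcases zmod_two_cases q with rfl | rfl <;> simp

theorem koszul_ne_zero (p q : ZMod 2) : koszul p q ≠ 0 := fun h => by
  simpa [h] using koszul_mul_self p q

theorem koszul_add_right (p q r : ZMod 2) :
    koszul p (q + r) = koszul p q * koszul p r := by
  rcases zmod_two_cases p with rfl | rfl <;> rcases zmod_two_cases q with rfl | rfl <;>
    rcases zmod_two_cases r with rfl | rfl <;> simp [zmod_two_one_add_one]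

theorem koszul_add_left (p q r : ZMod 2) :
    koszul (p + q) r = koszul p r * koszul q r := by
  rw [koszul_comm, koszul_add_right, koszul_comm r, koszul_comm r]

@[simp] theorem idxParity_inl {n : ℕ} (i : Fin n) : idxParity (Sum.inl i : Idx n) = 0 := rfl

@[simp] theorem idxParity_inr {n : ℕ} (i : Fin n) : idxParity (Sum.inr i : Idx n) = 1 := rfl

@[simp] theorem idxParity_swap {n : ℕ} (i : Idx n) : idxParity i.swap = idxParity i + 1 := by
  rcases i with i | i <;> simp [zmod_two_one_add_one]

/-! ### The supercommutator of arbitrary matrices -/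

/-- The bilinear extension of the supercommutator to matrices which need not be homogeneous:
the matrix unit `E_{ab}` has parity `p(a) + p(b)`. -/
def sbr : Mat n →ₗ[ℂ] Mat n →ₗ[ℂ] Mat n :=
  LinearMap.mk₂ ℂ
    (fun X Y => Matrix.of fun a b => ∑ c, (X a c * Y c b -
      koszul (idxParity a + idxParity c) (idxParity c + idxParity b) * (Y a c * X c b)))
    (fun X X' Y => by
      ext a b
      simp only [Matrix.of_apply, Matrix.add_apply, ← Finset.sum_add_distrib]
      exact Finset.sum_congr rfl fun c _ => by ring)
    (fun t X Y => by
      ext a b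
      simp only [Matrix.of_apply, Matrix.smul_apply, smul_eq_mul, Finset.mul_sum]
      exact Finset.sum_congr rfl fun c _ => by ring)
    (fun X Y Y' => by
      ext a b
      simp only [Matrix.of_apply, Matrix.add_apply, ← Finset.sum_add_distrib]
      exact Finset.sum_congr rfl fun c _ => by ring)
    (fun t X Y => by
      ext a b
      simp only [Matrix.of_apply, Matrix.smul_apply, smul_eq_mul, Finset.mul_sum]
      exact Finset.sum_congr rfl fun c _ => by ring)

theorem sbr_apply (X Y : Mat n) (a b : Idx n) :
    sbr X Y a b = ∑ c, (X a c * Y c b -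
      koszul (idxParity a + idxParity c) (idxParity c + idxParity b) * (Y a c * X c b)) := rfl

theorem add_eq_of_eq_add {x y p : ZMod 2} (h : x = y + p) : x + y = p := by
  revert x y p; decide

theorem sbr_eq_superComm {p q : ZMod 2} {X Y : Mat n} (hX : HasParity p X)
    (hY : HasParity q Y) : sbr X Y = superComm p q X Y := by
  ext a b
  rw [sbr_apply, superComm, Matrix.sub_apply, Matrix.smul_apply, Matrix.mul_apply,
    Matrix.mul_apply, smul_eq_mul, Finset.mul_sum, ← Finset.sum_sub_distrib]
  refine Finset.sum_congr rfl fun c _ => ?_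
  congr 1
  by_cases h : Y a c = 0
  · simp [h]
  by_cases h' : X c b = 0
  · simp [h']
  rw [add_eq_of_eq_add (hY a c h), add_eq_of_eq_add (hX c b h'), koszul_comm]

theorem HasParity.sbr {p q : ZMod 2} {X Y : Mat n} (hX : HasParity p X)
    (hY : HasParity q Y) : HasParity (p + q) (sbr X Y) := by
  intro a b h
  rw [sbr_apply] at h
  obtain ⟨c, -, hc⟩ := Finset.exists_ne_zero_of_sum_ne_zero h
  by_cases h₁ : X a c * Y c b = 0
  · rw [h₁, zero_sub, neg_ne_zero] at hc
    have h₂ := right_ne_zero_of_mul hc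
    rw [hY a c (left_ne_zero_of_mul h₂), hX c b (right_ne_zero_of_mul h₂)]
    ring
  · rw [hX a c (left_ne_zero_of_mul h₁), hY c b (right_ne_zero_of_mul h₁)]
    ring

/-- The super Jacobi identity. As an identity of associative products with these signs it holds
for arbitrary matrices. -/
theorem superComm_jacobi (p q r : ZMod 2) (X Y Z : Mat n) :
    superComm (p + q) r (superComm p q X Y) Z =
      superComm p (q + r) X (superComm q r Y Z) +
        koszul q r • superComm (p + r) q (superComm p r X Z) Y := by
  simp only [superComm, koszul_add_left, koszul_add_right, mul_sub, sub_mul, smul_sub,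
    Matrix.smul_mul, Matrix.mul_smul, smul_smul, Matrix.mul_assoc, koszul_comm r q]
  have h := koszul_mul_self q r
  have e₁ : koszul q r * (koszul p q * koszul q r) = koszul p q := by
    linear_combination koszul p q * h
  have e₂ : koszul q r * (koszul p q * koszul q r * koszul p r) = koszul p q * koszul p r := by
    linear_combination koszul p q * koszul p r * h
  rw [e₁, e₂]
  module

/-- The Jacobi identity for the bracket of homogeneous matrices. -/
theorem sbr_jacobi {p q r : ZMod 2} {X Y Z : Mat n} (hX : HasParity p X) (hY : HasParity q Y)
    (hZ : HasParity r Z) :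
    sbr (sbr X Y) Z = sbr X (sbr Y Z) + koszul q r • sbr (sbr X Z) Y := by
  rw [sbr_eq_superComm (hX.sbr hY) hZ, sbr_eq_superComm hX (hY.sbr hZ),
    sbr_eq_superComm (hX.sbr hZ) hY, sbr_eq_superComm hX hY, sbr_eq_superComm hY hZ,
    sbr_eq_superComm hX hZ, superComm_jacobi]

/-- The component of parity `p` of a matrix. -/
def matPart (p : ZMod 2) (X : Mat n) : Mat n :=
  Matrix.of fun a b => if idxParity a = idxParity b + p then X a b else 0

theorem hasParity_matPart (p : ZMod 2) (X : Mat n) : HasParity p (matPart p X) := by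
  intro a b h
  by_contra h'
  simp [matPart, h'] at h

theorem matPart_zero_add_matPart_one (X : Mat n) : matPart 0 X + matPart 1 X = X := by
  ext a b
  rcases zmod_two_cases (idxParity a) with h | h <;>
    rcases zmod_two_cases (idxParity b) with h' | h' <;>
    simp [matPart, h, h', zmod_two_one_add_one]

/-! ### The periplectic Lie superalgebra in coordinates -/

/-- After lowering the row index with the odd form, `pe(n)` consists of the
super-antisymmetric matrices. -/
theorem mem_pe_iff (X : Mat n) :
    X ∈ pe n ↔ ∀ i k : Idx n,
      X i.swap k = -(koszul (idxParity i) (idxParity k) * X k.swap i) := by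
  constructor
  · rintro ⟨h₁, h₂, h₃⟩ i k
    have e₁ := fun i j => congrFun₂ h₁ i j
    have e₂ := fun i j => congrFun₂ h₂ i j
    have e₃ := fun i j => congrFun₂ h₃ i j
    simp only [toBlocks₁₁, toBlocks₁₂, toBlocks₂₁, toBlocks₂₂, Matrix.of_apply,
      Matrix.neg_apply, Matrix.transpose_apply] at e₁ e₂ e₃
    rcases i with i | i <;> rcases k with k | k <;> simp
    · rw [← e₃ k i]
    · exact e₁ i k
    · rw [e₁ k i, neg_neg]
    · exact e₂ k i
  · intro h
    refine ⟨?_, ?_, ?_⟩ <;> ext i j <;>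
      simp only [toBlocks₁₁, toBlocks₁₂, toBlocks₂₁, toBlocks₂₂, Matrix.of_apply,
        Matrix.neg_apply, Matrix.transpose_apply]
    · simpa using h (Sum.inl i) (Sum.inr j)
    · simpa using h (Sum.inr j) (Sum.inr i)
    · simpa using h (Sum.inl j) (Sum.inl i)

theorem str_eq_sum (X : Mat n) : str X = ∑ i, koszul 1 (idxParity i) * X i i := by
  simp [str, Matrix.trace, toBlocks₁₁, toBlocks₂₂, Fintype.sum_sum_type, sub_eq_add_neg]

theorem str_sbr (X Y : Mat n) : str (sbr X Y) = 0 := by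
  simp only [str_eq_sum, sbr_apply, Finset.mul_sum, mul_sub, Finset.sum_sub_distrib]
  rw [sub_eq_zero]
  conv_rhs => rw [Finset.sum_comm]
  refine Finset.sum_congr rfl fun a _ => Finset.sum_congr rfl fun c _ => ?_
  rcases zmod_two_cases (idxParity a) with h | h <;>
    rcases zmod_two_cases (idxParity c) with h' | h' <;>
    simp [h, h', zmod_two_one_add_one] <;> ring

/-- In lowered indices the two products in `[X, Y]` are exchanged by the super-antisymmetry of `X`
and `Y`, so `pe(n)` is closed under brackets, also of inhomogeneous elements. -/
theorem sbr_mem_pe {X Y : Mat n} (hX : X ∈ pe n) (hY : Y ∈ pe n) : sbr X Y ∈ pe n := by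
  rw [mem_pe_iff] at *
  intro i k
  rw [sbr_apply, sbr_apply, ← Equiv.sum_comp (Equiv.sumComm (Fin n) (Fin n)), Finset.mul_sum,
    ← Finset.sum_neg_distrib]
  refine Finset.sum_congr rfl fun c _ => ?_
  have h₁ := hX i c.swap
  have h₂ := hY c k
  have h₃ := hY i c.swap
  have h₄ := hX c k
  simp only [Equiv.sumComm_apply, Sum.swap_swap, idxParity_swap] at *
  rw [h₁, h₂, h₃, h₄]
  rcases zmod_two_cases (idxParity i) with h | h <;>
    rcases zmod_two_cases (idxParity c) with h' | h' <;>
    rcases zmod_two_cases (idxParity k) with h'' | h'' <;>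
    simp [h, h', h'', zmod_two_one_add_one] <;> ring

theorem sbr_mem_spe {X Y : Mat n} (hX : X ∈ pe n) (hY : Y ∈ pe n) : sbr X Y ∈ spe n :=
  ⟨sbr_mem_pe hX hY, str_sbr X Y⟩

/-! ### The part of degree `-1` of `pe(n+1)` -/

/-- The index of `e_{n+1}`. -/
def lastE : Idx (n + 1) := Sum.inl (Fin.last n)

/-- The index of `f_{n+1}`. -/
def lastF : Idx (n + 1) := Sum.inr (Fin.last n)

theorem idx_cases (a : Idx (n + 1)) : a = lastE ∨ a = lastF ∨ ∃ i : Idx n, a = embIdx i := by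
  rcases a with a | a <;> induction a using Fin.lastCases with
  | last => simp [lastE, lastF]
  | cast i => first
    | exact Or.inr (Or.inr ⟨Sum.inl i, rfl⟩)
    | exact Or.inr (Or.inr ⟨Sum.inr i, rfl⟩)

theorem embIdx_injective : Function.Injective (embIdx : Idx n → Idx (n + 1)) :=
  Sum.map_injective.2 ⟨Fin.castSucc_injective n, Fin.castSucc_injective n⟩

@[simp] theorem embIdx_inj {i j : Idx n} : embIdx i = embIdx j ↔ i = j :=
  embIdx_injective.eq_iff

@[simp] theorem embIdx_ne_lastE (i : Idx n) : embIdx i ≠ lastE := by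
  rcases i with i | i <;> simp [embIdx, lastE, Fin.castSucc_ne_last]

@[simp] theorem embIdx_ne_lastF (i : Idx n) : embIdx i ≠ lastF := by
  rcases i with i | i <;> simp [embIdx, lastF, Fin.castSucc_ne_last]

@[simp] theorem lastE_ne_embIdx (i : Idx n) : lastE ≠ embIdx i := (embIdx_ne_lastE i).symm

@[simp] theorem lastF_ne_embIdx (i : Idx n) : lastF ≠ embIdx i := (embIdx_ne_lastF i).symm

@[simp] theorem lastE_ne_lastF : (lastE : Idx (n + 1)) ≠ lastF := by simp [lastE, lastF]

@[simp] theorem lastF_ne_lastE : (lastF : Idx (n + 1)) ≠ lastE := by simp [lastE, lastF]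

@[simp] theorem swap_lastE : (lastE : Idx (n + 1)).swap = lastF := rfl

@[simp] theorem swap_lastF : (lastF : Idx (n + 1)).swap = lastE := rfl

@[simp] theorem swap_embIdx (i : Idx n) : (embIdx i).swap = embIdx i.swap := by
  rcases i with i | i <;> rfl

@[simp] theorem idxParity_lastE : idxParity (lastE : Idx (n + 1)) = 0 := rfl

@[simp] theorem idxParity_lastF : idxParity (lastF : Idx (n + 1)) = 1 := rfl

@[simp] theorem idxParity_embIdx (i : Idx n) : idxParity (embIdx i) = idxParity i := by
  rcases i with i | i <;> rfl

@[simp] theorem weight_lastE : weight (lastE : Idx (n + 1)) = 1 := by simp [weight, lastE]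

@[simp] theorem weight_lastF : weight (lastF : Idx (n + 1)) = -1 := by simp [weight, lastF]

@[simp] theorem weight_embIdx (i : Idx n) : weight (embIdx i) = 0 := by
  rcases i with i | i <;> simp [weight, embIdx, Fin.castSucc_ne_last]

theorem weight_swap (a : Idx (n + 1)) : weight a.swap = -weight a := by
  rcases idx_cases a with rfl | rfl | ⟨i, rfl⟩ <;> simp

theorem sum_idx_succ (f : Idx (n + 1) → ℂ) :
    ∑ a, f a = ∑ i : Idx n, f (embIdx i) + f lastE + f lastF := by
  simp only [Fintype.sum_sum_type, Fin.sum_univ_castSucc, embIdx, lastE, lastF, Sum.map_inl,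
    Sum.map_inr]
  ring

/-- Extension by zero from `ℂ^{n|n}` to `ℂ^{n+1|n+1}`. -/
def extZero : (Idx n → ℂ) →ₗ[ℂ] (Idx (n + 1) → ℂ) :=
  Function.ExtendByZero.linearMap ℂ embIdx

@[simp] theorem extZero_embIdx (v : Idx n → ℂ) (i : Idx n) : extZero v (embIdx i) = v i :=
  embIdx_injective.extend_apply v 0 i

@[simp] theorem extZero_lastE (v : Idx n → ℂ) : extZero v lastE = 0 :=
  Function.extend_apply' _ _ _ (by simp)

@[simp] theorem extZero_lastF (v : Idx n → ℂ) : extZero v lastF = 0 :=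
  Function.extend_apply' _ _ _ (by simp)

/-- The element of degree `-1` of `pe(n+1)` which maps `e_{n+1}` to `v`. -/
def lift : (Idx n → ℂ) →ₗ[ℂ] Mat (n + 1) where
  toFun v := Matrix.of fun a b =>
    (if b = lastE then extZero v a else 0) - (if a = lastF then extZero v b.swap else 0)
  map_add' v w := by
    ext a b
    by_cases h : b = lastE <;> by_cases h' : a = lastF <;> simp [h, h']; ring
  map_smul' c v := by
    ext a b
    by_cases h : b = lastE <;> by_cases h' : a = lastF <;> simp [h, h']

theorem lift_apply (v : Idx n → ℂ) (a b : Idx (n + 1)) :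
    lift v a b =
      (if b = lastE then extZero v a else 0) - (if a = lastF then extZero v b.swap else 0) := rfl

theorem lift_mem_pe (v : Idx n → ℂ) : lift v ∈ pe (n + 1) := by
  rw [mem_pe_iff]
  intro a b
  rcases idx_cases a with rfl | rfl | ⟨i, rfl⟩ <;> rcases idx_cases b with rfl | rfl | ⟨j, rfl⟩ <;>
    simp [lift_apply]

theorem lift_mem_spe (v : Idx n → ℂ) : lift v ∈ spe (n + 1) := by
  refine ⟨lift_mem_pe v, ?_⟩
  rw [str_eq_sum, sum_idx_succ]
  simp [lift_apply]

theorem hasDegree_lift (v : Idx n → ℂ) : HasDegree (-1) (lift v) := by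
  intro a b
  rcases idx_cases a with rfl | rfl | ⟨i, rfl⟩ <;> rcases idx_cases b with rfl | rfl | ⟨j, rfl⟩ <;>
    simp [lift_apply]

theorem hasParity_lift {p : ZMod 2} {v : Idx n → ℂ} (hv : v ∈ stdParity n p) :
    HasParity p (lift v) := by
  have hv' : ∀ i, v i ≠ 0 → idxParity i = p := fun i h => not_not.1 fun h' => h (hv i h')
  intro a b
  rcases idx_cases a with rfl | rfl | ⟨i, rfl⟩ <;> rcases idx_cases b with rfl | rfl | ⟨j, rfl⟩ <;>
    simp [lift_apply]
  · intro h
    have := hv' _ h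
    rw [← this, idxParity_swap, ← add_assoc, add_comm _ 1]
    rcases zmod_two_cases (idxParity j) with h | h <;> simp [h, zmod_two_one_add_one]
  · exact hv' i

/-- The entries of the supercommutator with an element of degree `-1`. -/
theorem sbr_lift_apply (Y : Mat (n + 1)) (v : Idx n → ℂ) (a b : Idx (n + 1)) :
    sbr Y (lift v) a b =
      (if b = lastE then ∑ j, Y a (embIdx j) * v j else 0) - Y a lastF * extZero v b.swap -
        koszul (idxParity a) (idxParity b) * extZero v a * Y lastE b +
        (if a = lastF then
          ∑ j, koszul (idxParity j) (idxParity b) * v j * Y (embIdx j.swap) b else 0) := by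
  have key : ∀ j : Idx n, koszul (idxParity j + 1) (idxParity b) =
      koszul (1 + idxParity j) (idxParity j + idxParity b) := fun j => by
    rcases zmod_two_cases (idxParity j) with h | h <;>
      rcases zmod_two_cases (idxParity b) with h' | h' <;> simp [h, h', zmod_two_one_add_one]
  have hF : ∑ j : Idx n, koszul (idxParity j) (idxParity b) * v j * Y (embIdx j.swap) b =
      ∑ j : Idx n, koszul (1 + idxParity j) (idxParity j + idxParity b) * v j.swap *
        Y (embIdx j) b := by
    rw [← Equiv.sum_comp (Equiv.sumComm (Fin n) (Fin n))]
    refine Finset.sum_congr rfl fun j _ => ?_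
    simp only [Equiv.sumComm_apply, Sum.swap_swap, key, idxParity_swap]
  rw [hF, sbr_apply, sum_idx_succ]
  simp only [lift_apply]
  rcases idx_cases a with rfl | rfl | ⟨i, rfl⟩ <;> rcases idx_cases b with rfl | rfl | ⟨j, rfl⟩ <;>
    simp [mul_assoc, Finset.sum_add_distrib, zmod_two_one_add_one, mul_comm, mul_left_comm] <;>
    ring

theorem sbr_lift_lift (v w : Idx n → ℂ) : sbr (lift v) (lift w) = 0 := by
  ext a b
  rw [sbr_lift_apply]
  simp only [lift_apply]
  rcases idx_cases a with rfl | rfl | ⟨i, rfl⟩ <;> rcases idx_cases b with rfl | rfl | ⟨j, rfl⟩ <;>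
    simp [-Fintype.sum_sum_type]
  rw [← sub_eq_neg_add, sub_eq_zero]
  exact Finset.sum_congr rfl fun j _ => mul_comm _ _

/-- The supercommutators with elements of degree `-1` supercommute. -/
theorem sbr_sbr_lift_comm {p q : ZMod 2} {v w : Idx n → ℂ} (hv : v ∈ stdParity n p)
    (hw : w ∈ stdParity n q) (Y : Mat (n + 1)) :
    sbr (sbr Y (lift v)) (lift w) = koszul p q • sbr (sbr Y (lift w)) (lift v) := by
  have key : ∀ r, sbr (sbr (matPart r Y) (lift v)) (lift w) =
      koszul p q • sbr (sbr (matPart r Y) (lift w)) (lift v) := fun r => by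
    rw [sbr_jacobi (hasParity_matPart r Y) (hasParity_lift hv) (hasParity_lift hw),
      sbr_lift_lift, map_zero, zero_add]
  rw [← matPart_zero_add_matPart_one Y]
  simp only [map_add, LinearMap.add_apply, key, smul_add]

/-! ### The grading of `pe(n+1)` -/

theorem HasDegree.sbr {d d' : ℤ} {X Y : Mat (n + 1)} (hX : HasDegree d X)
    (hY : HasDegree d' Y) : HasDegree (d + d') (sbr X Y) := by
  intro a b h
  rw [sbr_apply] at h
  obtain ⟨c, -, hc⟩ := Finset.exists_ne_zero_of_sum_ne_zero h
  by_cases h₁ : X a c * Y c b = 0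
  · rw [h₁, zero_sub, neg_ne_zero] at hc
    have h₂ := right_ne_zero_of_mul hc
    rw [hY a c (left_ne_zero_of_mul h₂), hX c b (right_ne_zero_of_mul h₂)]
    ring
  · rw [hX a c (left_ne_zero_of_mul h₁), hY c b (right_ne_zero_of_mul h₁)]
    ring

theorem HasDegree.sbr_lift {d : ℤ} {X : Mat (n + 1)} (hX : HasDegree d X) (v : Idx n → ℂ) :
    HasDegree (d - 1) (Periplectic.sbr X (lift v)) := hX.sbr (hasDegree_lift v)

theorem HasDegree.add {d : ℤ} {X Y : Mat (n + 1)} (hX : HasDegree d X) (hY : HasDegree d Y) :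
    HasDegree d (X + Y) := by
  intro a b h
  by_cases h' : X a b = 0
  · exact hY a b fun h'' => h (by simp [h', h''])
  · exact hX a b h'

theorem HasDegree.smul {d : ℤ} {X : Mat (n + 1)} (hX : HasDegree d X) (c : ℂ) :
    HasDegree d (c • X) :=
  fun a b h => hX a b fun h' => h (by simp [h'])

theorem HasDegree.sub {d : ℤ} {X Y : Mat (n + 1)} (hX : HasDegree d X) (hY : HasDegree d Y) :
    HasDegree d (X - Y) := by
  rw [sub_eq_add_neg, ← neg_one_smul ℂ Y]
  exact hX.add (hY.smul _)

theorem HasDegree.apply_eq_zero {d : ℤ} {X : Mat (n + 1)} (hX : HasDegree d X)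
    {a b : Idx (n + 1)} (h : weight a ≠ weight b + d) : X a b = 0 :=
  not_not.1 fun h' => h (hX a b h')

/-- The component of degree `d` of a matrix. -/
def degPart (d : ℤ) (X : Mat (n + 1)) : Mat (n + 1) :=
  Matrix.of fun a b => if weight a = weight b + d then X a b else 0

theorem hasDegree_degPart (d : ℤ) (X : Mat (n + 1)) : HasDegree d (degPart d X) := by
  intro a b h
  by_contra h'
  simp [degPart, h'] at h

theorem degPart_eq_zero {d : ℤ} (hd : d ∉ Finset.Icc (-2 : ℤ) 2) (X : Mat (n + 1)) :
    degPart d X = 0 := by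
  rw [Finset.mem_Icc] at hd
  ext a b
  apply (hasDegree_degPart d X).apply_eq_zero
  rcases idx_cases a with rfl | rfl | ⟨i, rfl⟩ <;>
    rcases idx_cases b with rfl | rfl | ⟨j, rfl⟩ <;> simp <;> omega

theorem sum_degPart (X : Mat (n + 1)) : ∑ d ∈ Finset.Icc (-2 : ℤ) 2, degPart d X = X := by
  ext a b
  have h : weight a - weight b ∈ Finset.Icc (-2 : ℤ) 2 := by
    rcases idx_cases a with rfl | rfl | ⟨i, rfl⟩ <;>
      rcases idx_cases b with rfl | rfl | ⟨j, rfl⟩ <;> simp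
  rw [Matrix.sum_apply, Finset.sum_eq_single_of_mem _ h]
  · simp [degPart]
  · intro d _ hd
    have : weight a ≠ weight b + d := fun h => hd (by omega)
    simp [degPart, this]

theorem degPart_mem_pe {X : Mat (n + 1)} (hX : X ∈ pe (n + 1)) (d : ℤ) :
    degPart d X ∈ pe (n + 1) := by
  rw [mem_pe_iff] at *
  intro a b
  have h : weight a.swap = weight b + d ↔ weight b.swap = weight a + d := by
    rw [weight_swap, weight_swap]
    omega
  simp only [degPart, Matrix.of_apply, h]
  by_cases h' : weight b.swap = weight a + d
  · simp only [h', if_true, hX a b]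
  · simp [h']

/-- Transitivity: in degree at least `0`, only zero supercommutes with the part of
degree `-1`. -/
theorem eq_zero_of_sbr_lift_eq_zero (hn : 1 ≤ n) {Y : Mat (n + 1)} (hY : Y ∈ pe (n + 1)) {d : ℤ}
    (hd : 0 ≤ d) (hYd : HasDegree d Y) (h : ∀ v, sbr Y (lift v) = 0) : Y = 0 := by
  rw [mem_pe_iff] at hY
  have e : ∀ j a b, sbr Y (lift (Pi.single j 1)) a b = 0 := fun j a b => by
    rw [h]; rfl
  simp only [sbr_lift_apply] at e
  have hLj : ∀ j, Y lastE (embIdx j) = 0 := fun j => by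
    simpa [Pi.single_apply] using e j lastE lastE
  have hLF : Y lastE lastF = 0 := by
    simpa using e (Sum.inl ⟨0, hn⟩) lastE (embIdx (Sum.inr ⟨0, hn⟩))
  have hij : ∀ i j, Y (embIdx i) (embIdx j) = if i = j then Y lastE lastE else 0 := by
    intro i j
    have := e j (embIdx i) lastE
    simp [Pi.single_apply] at this
    simpa using sub_eq_zero.1 this
  have hLL : Y lastE lastE = 0 := by
    have h₁ := hY (embIdx (Sum.inl ⟨0, hn⟩)) (embIdx (Sum.inr ⟨0, hn⟩))
    simp only [swap_embIdx, hij, Sum.swap_inl, Sum.swap_inr, idxParity_embIdx, idxParity_inl,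
      koszul_zero_left, one_mul, if_true] at h₁
    exact self_eq_neg.1 h₁
  have hFF : Y lastF lastF = 0 := by simpa [hLL] using hY lastE lastF
  have hjF : ∀ j, Y (embIdx j) lastF = 0 := fun j => by
    simpa [hLj] using hY (embIdx j.swap) lastF
  ext a b
  rcases idx_cases a with rfl | rfl | ⟨i, rfl⟩ <;>
    rcases idx_cases b with rfl | rfl | ⟨j, rfl⟩ <;>
    first
    | assumption
    | exact hLj _
    | exact hjF _
    | exact hYd.apply_eq_zero (by simp; omega)
    | simp [hij, hLL]

/-! ### Realization of matrices as formal vector fields on `ℂ^{n|n}` -/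

/-- The map `gl(n+1|n+1) → ∏ Hom(V, …, Hom(V, V))` given in degree `-1` by `Y ↦ Y e_{n+1}` and
determined in the other degrees by `[Φ(Y), v] = Φ([Y, v])` for `v ∈ V`. -/
def realize : (k : ℕ) → Mat (n + 1) →ₗ[ℂ] Tower (Idx n → ℂ) k
  | 0 => (towerZero (V := Idx n → ℂ)).symm.toLinearMap ∘ₗ
      { toFun := fun Y i => Y (embIdx i) lastE
        map_add' := fun _ _ => rfl
        map_smul' := fun _ _ => rfl }
  | k + 1 => (towerSucc (V := Idx n → ℂ) k).symm.toLinearMap ∘ₗ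
      LinearMap.mk₂ ℂ (fun Y v => realize k (sbr Y (lift v)))
        (fun X Y v => by simp) (fun c X v => by simp)
        (fun X v w => by simp) (fun c X v => by simp)

theorem realize_zero_apply (Y : Mat (n + 1)) (i : Idx n) :
    towerZero (realize 0 Y) i = Y (embIdx i) lastE := rfl

theorem realize_succ_apply (k : ℕ) (Y : Mat (n + 1)) (v : Idx n → ℂ) :
    towerSucc k (realize (k + 1) Y) v = realize k (sbr Y (lift v)) := rfl

theorem tower_succ_ext {V : Type*} [AddCommGroup V] [Module ℂ V] {k : ℕ} {X Y : Tower V (k + 1)}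
    (h : ∀ v, towerSucc k X v = towerSucc k Y v) : X = Y :=
  (towerSucc k).injective (LinearMap.ext h)

theorem tower_ext_single {k : ℕ} {X Y : Tower (Idx n → ℂ) (k + 1)}
    (h : ∀ j, towerSucc k X (Pi.single j 1) = towerSucc k Y (Pi.single j 1)) : X = Y := by
  apply (towerSucc k).injective
  apply (Pi.basisFun ℂ (Idx n)).ext
  simpa using h

theorem realize_lift_zero (v : Idx n → ℂ) : towerZero (realize 0 (lift v)) = v := by
  ext i
  simp [realize_zero_apply, lift_apply]

/-- The part of degree `0` acts on `V = ⟨x e_{n+1}⟩` by its restriction to `ℂ^{n|n}`, shifted by a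
scalar coming from the weight of `e_{n+1}`. -/
theorem realize_one_apply (Y : Mat (n + 1)) :
    towerOne (realize 1 Y) =
      Matrix.toLin' (Y.submatrix embIdx embIdx - Y lastE lastE • (1 : Mat n)) := by
  ext j i
  change sbr Y (lift (Pi.single j 1)) (embIdx i) lastE = _
  rw [sbr_lift_apply]
  simp [-Fintype.sum_sum_type, Pi.single_apply, eq_comm]

theorem realize_eq_zero_of_hasDegree {d : ℤ} {Y : Mat (n + 1)} (hY : HasDegree d Y) {k : ℕ}
    (hk : (k : ℤ) - 1 ≠ d) : realize k Y = 0 := by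
  induction k generalizing d Y with
  | zero =>
    apply (towerZero (V := Idx n → ℂ)).injective
    ext i
    rw [realize_zero_apply, hY.apply_eq_zero]
    · simp
    · simp at hk ⊢
      omega
  | succ k ih =>
    apply tower_succ_ext
    intro v
    rw [realize_succ_apply, ih (hY.sbr_lift v) (by push_cast at hk; omega)]
    simp

/-- The component of degree `k - 1` of the vector field depends only on the part of degree `k - 1`
of the matrix. -/
theorem realize_degPart (Y : Mat (n + 1)) (k : ℕ) :
    realize k (degPart (k - 1) Y) = realize k Y := by
  conv_rhs => rw [← sum_degPart Y, map_sum]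
  by_cases h : (k : ℤ) - 1 ∈ Finset.Icc (-2 : ℤ) 2
  · rw [Finset.sum_eq_single_of_mem _ h]
    intro d _ hd
    exact realize_eq_zero_of_hasDegree (hasDegree_degPart d Y) hd.symm
  · rw [Finset.sum_eq_zero fun d hd => realize_eq_zero_of_hasDegree (hasDegree_degPart d Y)
      fun hd' => h (hd' ▸ hd)]
    rw [degPart_eq_zero h, map_zero]

theorem realize_mem_towerParity {p : ZMod 2} {Y : Mat (n + 1)} (hY : HasParity p Y) (k : ℕ) :
    realize k Y ∈ towerParity (stdParity n) k p := by
  induction k generalizing p Y with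
  | zero =>
    intro i hi
    rw [LinearEquiv.coe_coe, realize_zero_apply]
    by_contra h
    exact hi (by simpa using hY _ _ h)
  | succ k ih => exact fun q v hv => ih (hY.sbr (hasParity_lift hv))

/-- In each degree the realization of `pe(n+1)` is faithful. -/
theorem eq_zero_of_realize_eq_zero (hn : 1 ≤ n) {k : ℕ} {Y : Mat (n + 1)} (hY : Y ∈ pe (n + 1))
    (hYd : HasDegree ((k : ℤ) - 1) Y) (h : realize k Y = 0) : Y = 0 := by
  induction k generalizing Y with
  | zero =>
    have hE : ∀ i, Y (embIdx i) lastE = 0 := fun i => by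
      change towerZero (realize 0 Y) i = 0
      rw [h]
      simp
    rw [mem_pe_iff] at hY
    ext a b
    rcases idx_cases a with rfl | rfl | ⟨i, rfl⟩ <;>
      rcases idx_cases b with rfl | rfl | ⟨j, rfl⟩ <;>
      first
      | exact hE _
      | (apply hYd.apply_eq_zero; simp; done)
      | skip
    simpa [hE] using hY lastE (embIdx j)
  | succ k ih =>
    refine eq_zero_of_sbr_lift_eq_zero hn hY (by push_cast; omega) hYd fun v => ?_
    apply ih (sbr_mem_pe hY (lift_mem_pe v))
    · have := hYd.sbr_lift v
      push_cast at this
      rwa [add_sub_cancel_right] at this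
    · rw [← realize_succ_apply, h]
      simp

theorem eq_zero_of_forall_realize_eq_zero (hn : 1 ≤ n) {Y : Mat (n + 1)} (hY : Y ∈ pe (n + 1))
    (h : ∀ k, realize k Y = 0) : Y = 0 := by
  rw [← sum_degPart Y]
  refine Finset.sum_eq_zero fun d hd => ?_
  rw [Finset.mem_Icc] at hd
  by_cases hd' : d = -2
  · have hY' := (mem_pe_iff _).1 (degPart_mem_pe hY d)
    have hYd := hasDegree_degPart d Y
    ext a b
    rcases idx_cases a with rfl | rfl | ⟨i, rfl⟩ <;>
      rcases idx_cases b with rfl | rfl | ⟨j, rfl⟩ <;>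
      first
      | (apply hYd.apply_eq_zero; simp [hd']; done)
      | exact self_eq_neg.1 (by simpa using hY' lastE lastE)
  · obtain ⟨k, rfl⟩ : ∃ k : ℕ, d = (k : ℤ) - 1 := ⟨(d + 1).toNat, by omega⟩
    exact eq_zero_of_realize_eq_zero hn (degPart_mem_pe hY _) (hasDegree_degPart _ _)
      (by rw [realize_degPart, h])

theorem parityProj_mem {V : Type*} [AddCommGroup V] [Module ℂ V] (𝒱 : ZMod 2 → Submodule ℂ V)
    [DirectSum.Decomposition 𝒱] (r : ZMod 2) (v : V) : parityProj 𝒱 r v ∈ 𝒱 r :=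
  Subtype.property _

theorem sum_parityProj {V : Type*} [AddCommGroup V] [Module ℂ V] (𝒱 : ZMod 2 → Submodule ℂ V)
    [DirectSum.Decomposition 𝒱] (v : V) : ∑ r, parityProj 𝒱 r v = v := by
  classical
  conv_rhs => rw [← DirectSum.sum_support_decompose 𝒱 v]
  refine (Finset.sum_subset (Finset.subset_univ _) fun r _ hr => ?_).symm
  have h : (DirectSum.decompose 𝒱 v r : V) = 0 := by simpa using hr
  exact h

/-- The realization of `pe(n+1)` respects the brackets. -/
theorem realize_superComm {p q : ZMod 2} {X Y : Mat (n + 1)} (hX : X ∈ pe (n + 1))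
    (hY : Y ∈ pe (n + 1)) (hpX : HasParity p X) (hqY : HasParity q Y) (k : ℕ) :
    realize k (sbr X Y) =
      superBracketComp (stdParity n) p q k (fun k => realize k X) (fun k => realize k Y) := by
  induction k generalizing p q X Y with
  | zero =>
    have hXL : X lastF lastE = 0 :=
      self_eq_neg.1 (by simpa using (mem_pe_iff X).1 hX lastE lastE)
    have hYL : Y lastF lastE = 0 :=
      self_eq_neg.1 (by simpa using (mem_pe_iff Y).1 hY lastE lastE)
    apply (towerZero (V := Idx n → ℂ)).injective
    ext i
    change sbr X Y (embIdx i) lastE =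
      sbr X (lift (towerZero (realize 0 Y))) (embIdx i) lastE -
        koszul p q * sbr Y (lift (towerZero (realize 0 X))) (embIdx i) lastE
    simp only [sbr_lift_apply, realize_zero_apply]
    rw [sbr_eq_superComm hpX hqY, superComm, Matrix.sub_apply, Matrix.smul_apply,
      Matrix.mul_apply, Matrix.mul_apply, sum_idx_succ, sum_idx_succ]
    -- The diagonal entries `X lastE lastE` and `Y lastE lastE` vanish unless `p = 0`,
    -- respectively `q = 0`, in which case the sign `koszul p q` is `1`.
    have e : X (embIdx i) lastE * Y lastE lastE -
        koszul p q * (Y (embIdx i) lastE * X lastE lastE) =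
          koszul p q * (X (embIdx i) lastE * Y lastE lastE) -
            Y (embIdx i) lastE * X lastE lastE := by
      by_cases hX0 : X lastE lastE = 0
      · by_cases hY0 : Y lastE lastE = 0
        · simp [hX0, hY0]
        · have : q = 0 := by simpa [eq_comm] using hqY _ _ hY0
          simp [this, hX0]
      · have : p = 0 := by simpa [eq_comm] using hpX _ _ hX0
        simp [this]
    simp [-Fintype.sum_sum_type, hXL, hYL, realize_zero_apply]
    linear_combination e
  | succ k ih =>
    apply tower_succ_ext
    intro v
    rw [realize_succ_apply]
    conv_lhs => rw [← sum_parityProj (stdParity n) v]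
    have hsum : towerSucc k (superBracketComp (stdParity n) p q (k + 1)
        (fun k => realize k X) (fun k => realize k Y)) v = ∑ r,
          (superBracketComp (stdParity n) p (q + r) k (fun k => realize k X)
              (fun k => realize k (sbr Y (lift (parityProj (stdParity n) r v)))) +
            koszul q r • superBracketComp (stdParity n) (p + r) q k
              (fun k => realize k (sbr X (lift (parityProj (stdParity n) r v))))
              (fun k => realize k Y)) := by
      simp only [superBracketComp, LinearMap.mk₂_apply, LinearEquiv.apply_symm_apply,
        LinearMap.sum_apply]
      rfl
    rw [hsum, map_sum, map_sum, map_sum]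
    refine Finset.sum_congr rfl fun r _ => ?_
    have hr := hasParity_lift (parityProj_mem (stdParity n) r v)
    rw [sbr_jacobi hpX hqY hr, map_add, map_smul,
      ih hX (sbr_mem_pe hY (lift_mem_pe _)) hpX (hqY.sbr hr),
      ih (sbr_mem_pe hX (lift_mem_pe _)) hY (hpX.sbr hr) hqY]

/-! ### Terms of the prolongations and the vanishing for `pe(n)` -/

theorem mem_prolongTerm_succ_succ {g : Submodule ℂ (Mat n)} {k : ℕ}
    {X : Tower (Idx n → ℂ) (k + 2)} :
    X ∈ prolongTerm g (k + 2) ↔ (∀ v, towerSucc (k + 1) X v ∈ prolongTerm g (k + 1)) ∧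
      ∀ p q, ∀ v ∈ stdParity n p, ∀ w ∈ stdParity n q,
        towerSucc k (towerSucc (k + 1) X v) w =
          koszul p q • towerSucc k (towerSucc (k + 1) X w) v :=
  Iff.rfl

theorem mem_prolongTerm_one {g : Submodule ℂ (Mat n)} {X : Tower (Idx n → ℂ) 1} :
    X ∈ prolongTerm g 1 ↔ ∃ M ∈ g, Matrix.toLin' M = towerOne X :=
  Iff.rfl

theorem prolongTerm_mono {g g' : Submodule ℂ (Mat n)} (h : g ≤ g') :
    ∀ k, prolongTerm g k ≤ prolongTerm g' k
  | 0 => le_rfl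
  | 1 => Submodule.comap_mono (Submodule.map_mono h)
  | k + 2 => fun _ hX => ⟨fun v => prolongTerm_mono h (k + 1) (hX.1 v), hX.2⟩

theorem single_mem_stdParity (j : Idx n) :
    (Pi.single j 1 : Idx n → ℂ) ∈ stdParity n (idxParity j) := by
  intro i hi
  rw [Pi.single_apply, if_neg]
  rintro rfl
  exact hi rfl

theorem map_mem_of_single_mem {T : Type*} [AddCommGroup T] [Module ℂ T]
    (f : (Idx n → ℂ) →ₗ[ℂ] T) {S : Submodule ℂ T} (h : ∀ j, f (Pi.single j 1) ∈ S)
    (v : Idx n → ℂ) : f v ∈ S := by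
  rw [← (Pi.basisFun ℂ (Idx n)).sum_repr v, map_sum]
  exact Submodule.sum_mem _ fun j _ => by simpa using S.smul_mem (v j) (h j)

theorem prolongTerm_eq_bot_of_le {g : Submodule ℂ (Mat n)} {m : ℕ} (hm : 1 ≤ m)
    (h : prolongTerm g m = ⊥) {k : ℕ} (hk : m ≤ k) : prolongTerm g k = ⊥ := by
  induction k, hk using Nat.le_induction with
  | base => exact h
  | succ k hk ih =>
    obtain ⟨k, rfl⟩ := Nat.exists_eq_add_of_le' (hm.trans hk)
    refine (Submodule.eq_bot_iff _).2 fun X hX => tower_succ_ext fun v => ?_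
    have := hX.1 v
    change _ ∈ prolongTerm g (k + 1) at this
    rw [ih, Submodule.mem_bot] at this
    rw [this]
    simp

/-- A tensor which is supersymmetric in two of its three arguments and super-antisymmetric in
another two vanishes: this is the braid relation for the transpositions of three letters. -/
theorem prolongTerm_pe_two : prolongTerm (pe n) 2 = ⊥ := by
  refine (Submodule.eq_bot_iff _).2 fun X hX => ?_
  obtain ⟨hX, hs⟩ := mem_prolongTerm_succ_succ.1 hX
  let N : Idx n → Idx n → Idx n → ℂ := fun j i k =>
    towerZero (towerSucc 0 (towerSucc 1 X (Pi.single j 1)) (Pi.single k 1)) i.swap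
  have hsym : ∀ j i k, N j i k = koszul (idxParity j) (idxParity k) * N k i j := fun j i k => by
    simp only [N]
    rw [hs _ _ _ (single_mem_stdParity j) _ (single_mem_stdParity k)]
    simp
  have hanti : ∀ j i k, N j i k = -(koszul (idxParity i) (idxParity k) * N j k i) := by
    intro j i k
    obtain ⟨M, hM, hMX⟩ := mem_prolongTerm_one.1 (hX (Pi.single j 1))
    have hN : ∀ i k, N j i k = M i.swap k := fun i k => by
      change towerOne (towerSucc 1 X (Pi.single j 1)) (Pi.single k 1) i.swap = _
      rw [← hMX]
      simp
    rw [hN, hN]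
    exact (mem_pe_iff M).1 hM i k
  -- Five alternating transpositions return `N j k i`, the argument order produced by one `hanti`,
  -- but with the opposite sign.
  have hN : ∀ j i k, N j i k = 0 := fun j i k => by
    have h₁ := hsym j i k
    rw [hanti k i j, hsym k j i, hanti i j k, hsym i k j] at h₁
    have h₂ := hanti j i k
    have e₁ := koszul_mul_self (idxParity j) (idxParity k)
    have e₂ := koszul_mul_self (idxParity i) (idxParity j)
    rw [koszul_comm (idxParity k) (idxParity i)] at h₁
    have : N j i k = koszul (idxParity i) (idxParity k) * N j k i := by
      rw [h₁]
      linear_combination (koszul (idxParity i) (idxParity j) ^ 2 *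
        koszul (idxParity i) (idxParity k) * N j k i) * e₁ +
        (koszul (idxParity i) (idxParity k) * N j k i) * e₂
    linear_combination (this + h₂) / 2
  refine tower_ext_single fun j => tower_ext_single fun k => ?_
  apply (towerZero (V := Idx n → ℂ)).injective
  ext i
  simpa [N] using hN j i.swap k

/-! ### Homogeneous elements of `pe(n+1)` -/

theorem submatrix_mem_pe {Y : Mat (n + 1)} (hY : Y ∈ pe (n + 1)) :
    Y.submatrix embIdx embIdx ∈ pe n := by
  rw [mem_pe_iff] at *
  intro i k
  simpa using hY (embIdx i) (embIdx k)

theorem apply_lastF_lastF {Y : Mat (n + 1)} (hY : Y ∈ pe (n + 1)) :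
    Y lastF lastF = -Y lastE lastE := by
  simpa using (mem_pe_iff Y).1 hY lastE lastF

theorem apply_embIdx_lastF {Y : Mat (n + 1)} (hY : Y ∈ pe (n + 1)) (i : Idx n) :
    Y (embIdx i) lastF = koszul 1 (idxParity i) * Y lastE (embIdx i.swap) := by
  have h := (mem_pe_iff Y).1 hY (embIdx i.swap) lastF
  rcases zmod_two_cases (idxParity i) with h' | h' <;>
    simpa [h', zmod_two_one_add_one] using h

theorem str_submatrix {Y : Mat (n + 1)} (hY : Y ∈ pe (n + 1)) :
    str (Y.submatrix embIdx embIdx) = str Y - 2 * Y lastE lastE := by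
  rw [str_eq_sum, str_eq_sum, sum_idx_succ, apply_lastF_lastF hY]
  simp [-Fintype.sum_sum_type]
  ring

/-- The element of degree `0` of `pe(n+1)` which restricts to `M` on `ℂ^{n|n}` and multiplies
`e_{n+1}` by `c`. -/
def degZeroMat (M : Mat n) (c : ℂ) : Mat (n + 1) := Matrix.of fun a b =>
  extZero (fun i => extZero (M i) b) a + (if a = lastE ∧ b = lastE then c else 0) -
    (if a = lastF ∧ b = lastF then c else 0)

/-- The element of degree `1` of `pe(n+1)` with row `c` at `e_{n+1}`. -/
def degOneMat (c : Idx n → ℂ) : Mat (n + 1) := Matrix.of fun a b =>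
  (if a = lastE then extZero c b else 0) +
    (if b = lastF then koszul 1 (idxParity a) * extZero c a.swap else 0)

/-- The element of degree `2` of `pe(n+1)` which maps `f_{n+1}` to `c e_{n+1}`. -/
def degTwoMat (c : ℂ) : Mat (n + 1) := Matrix.of fun a b =>
  if a = lastE ∧ b = lastF then c else 0

theorem degZeroMat_mem_pe {M : Mat n} (hM : M ∈ pe n) (c : ℂ) :
    degZeroMat M c ∈ pe (n + 1) := by
  rw [mem_pe_iff] at *
  intro a b
  rcases idx_cases a with rfl | rfl | ⟨i, rfl⟩ <;> rcases idx_cases b with rfl | rfl | ⟨j, rfl⟩ <;>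
    simp [degZeroMat]
  exact hM i j

theorem hasDegree_degZeroMat (M : Mat n) (c : ℂ) : HasDegree 0 (degZeroMat M c) := by
  intro a b
  rcases idx_cases a with rfl | rfl | ⟨i, rfl⟩ <;> rcases idx_cases b with rfl | rfl | ⟨j, rfl⟩ <;>
    simp [degZeroMat]

theorem realize_one_degZeroMat (M : Mat n) (c : ℂ) :
    towerOne (realize 1 (degZeroMat M c)) = Matrix.toLin' (M - c • (1 : Mat n)) := by
  rw [realize_one_apply]
  congr 2
  · ext i j
    simp [degZeroMat]
  · simp [degZeroMat]

theorem degOneMat_mem_pe (c : Idx n → ℂ) : degOneMat c ∈ pe (n + 1) := by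
  rw [mem_pe_iff]
  intro a b
  rcases idx_cases a with rfl | rfl | ⟨i, rfl⟩ <;> rcases idx_cases b with rfl | rfl | ⟨j, rfl⟩ <;>
    simp [degOneMat]
  · rcases zmod_two_cases (idxParity j) with h | h <;> simp [h, zmod_two_one_add_one]
  · rcases zmod_two_cases (idxParity i) with h | h <;> simp [h, zmod_two_one_add_one]

theorem hasDegree_degOneMat (c : Idx n → ℂ) : HasDegree 1 (degOneMat c) := by
  intro a b
  rcases idx_cases a with rfl | rfl | ⟨i, rfl⟩ <;> rcases idx_cases b with rfl | rfl | ⟨j, rfl⟩ <;>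
    simp [degOneMat]

theorem degTwoMat_mem_pe (c : ℂ) : (degTwoMat c : Mat (n + 1)) ∈ pe (n + 1) := by
  rw [mem_pe_iff]
  intro a b
  rcases idx_cases a with rfl | rfl | ⟨i, rfl⟩ <;> rcases idx_cases b with rfl | rfl | ⟨j, rfl⟩ <;>
    simp [degTwoMat]

theorem hasDegree_degTwoMat (c : ℂ) : HasDegree 2 (degTwoMat c : Mat (n + 1)) := by
  intro a b
  rcases idx_cases a with rfl | rfl | ⟨i, rfl⟩ <;> rcases idx_cases b with rfl | rfl | ⟨j, rfl⟩ <;>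
    simp [degTwoMat]

theorem eq_zero_of_hasDegree_one {Y : Mat (n + 1)} (hY : Y ∈ pe (n + 1)) (hYd : HasDegree 1 Y)
    (h : ∀ j, Y lastE (embIdx j) = 0) : Y = 0 := by
  ext a b
  rcases idx_cases a with rfl | rfl | ⟨i, rfl⟩ <;>
    rcases idx_cases b with rfl | rfl | ⟨j, rfl⟩ <;>
    first
    | exact h _
    | (apply hYd.apply_eq_zero; simp; done)
    | simp [apply_embIdx_lastF hY, h]

theorem eq_zero_of_hasDegree_two {Y : Mat (n + 1)} (hYd : HasDegree 2 Y)
    (h : Y lastE lastF = 0) : Y = 0 := by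
  ext a b
  rcases idx_cases a with rfl | rfl | ⟨i, rfl⟩ <;>
    rcases idx_cases b with rfl | rfl | ⟨j, rfl⟩ <;>
    first
    | exact h
    | (apply hYd.apply_eq_zero; simp)

/-! ### The prolongation of `cpe(n)` -/

theorem realize_mem_prolongTerm {L : Submodule ℂ (Mat (n + 1))} {g : Submodule ℂ (Mat n)}
    (hcl : ∀ Y ∈ L, ∀ v, sbr Y (lift v) ∈ L) (h₁ : ∀ Y ∈ L, realize 1 Y ∈ prolongTerm g 1) :
    ∀ (k : ℕ), ∀ Y ∈ L, realize k Y ∈ prolongTerm g k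
  | 0 => fun _ _ => Submodule.mem_top
  | 1 => h₁
  | k + 2 => fun Y hY => mem_prolongTerm_succ_succ.2
      ⟨fun v => by
        rw [realize_succ_apply]
        exact realize_mem_prolongTerm hcl h₁ (k + 1) _ (hcl Y hY v),
      fun p q v hv w hw => by
        simp only [realize_succ_apply]
        rw [sbr_sbr_lift_comm hv hw, map_smul]⟩

theorem mem_cpe {M : Mat n} : M ∈ cpe n ↔ ∃ P ∈ pe n, ∃ c : ℂ, P + c • (1 : Mat n) = M := by
  simp [cpe, Submodule.mem_sup, Submodule.mem_span_singleton, zed]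

theorem mem_speExt {a b : ℂ} {M : Mat n} :
    M ∈ speExt n a b ↔ ∃ P ∈ spe n, ∃ c : ℂ, P + c • (a • tau n + b • (1 : Mat n)) = M := by
  simp [speExt, Submodule.mem_sup, Submodule.mem_span_singleton, zed]

theorem cspe_eq_speExt : cspe n = speExt n 0 1 := by simp [cspe, speExt]

theorem tau_mem_pe : tau n ∈ pe n := by
  refine ⟨?_, ?_, ?_⟩ <;> simp [tau]

theorem str_tau : str (tau n) = 2 * n := by
  simp [str, tau]
  ring

theorem speExt_le_cpe (a b : ℂ) : speExt n a b ≤ cpe n := by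
  intro M hM
  obtain ⟨P, hP, c, rfl⟩ := mem_speExt.1 hM
  refine mem_cpe.2 ⟨P + (c * a) • tau n, add_mem hP.1 (Submodule.smul_mem _ _ tau_mem_pe),
    c * b, ?_⟩
  module

theorem str_add (X Y : Mat n) : str (X + Y) = str X + str Y := by
  simp [str_eq_sum, Finset.sum_add_distrib, mul_add]

theorem str_smul (c : ℂ) (X : Mat n) : str (c • X) = c * str X := by
  simp [str_eq_sum, Finset.mul_sum, mul_add, mul_left_comm]

theorem realize_one_mem_cpe {Y : Mat (n + 1)} (hY : Y ∈ pe (n + 1)) :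
    realize 1 Y ∈ prolongTerm (cpe n) 1 := by
  refine mem_prolongTerm_one.2 ⟨_, ?_, (realize_one_apply Y).symm⟩
  exact mem_cpe.2 ⟨_, submatrix_mem_pe hY, -Y lastE lastE, by module⟩

/-- On `spe(n+1)` the eigenvalue at `e_{n+1}` is determined by the supertrace of the restriction to
`ℂ^{n|n}`. -/
theorem realize_one_mem_speExt (hn : 1 ≤ n) {Y : Mat (n + 1)} (hY : Y ∈ spe (n + 1)) :
    realize 1 Y ∈ prolongTerm (speExt n 1 n) 1 := by
  have hn' : (n : ℂ) ≠ 0 := by exact_mod_cast (by omega : n ≠ 0)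
  refine mem_prolongTerm_one.2 ⟨_, ?_, (realize_one_apply Y).symm⟩
  -- The coefficient of `τ + nz` is determined by that of `z`.
  refine mem_speExt.2 ⟨Y.submatrix embIdx embIdx + (Y lastE lastE / n) • tau n,
    ⟨add_mem (submatrix_mem_pe hY.1) (Submodule.smul_mem _ _ tau_mem_pe), ?_⟩,
    -(Y lastE lastE / n), ?_⟩
  · rw [str_add, str_smul, str_submatrix hY.1, hY.2, str_tau]
    field_simp
    ring
  · have e : (Y lastE lastE / n) * n = Y lastE lastE := by field_simp
    conv_rhs => rw [← e]
    module

theorem realize_mem_prolongTerm_cpe (k : ℕ) {Y : Mat (n + 1)} (hY : Y ∈ pe (n + 1)) :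
    realize k Y ∈ prolongTerm (cpe n) k :=
  realize_mem_prolongTerm (fun _ hY v => sbr_mem_pe hY (lift_mem_pe v))
    (fun _ hY => realize_one_mem_cpe hY) k Y hY

theorem realize_mem_prolongTerm_speExt (hn : 1 ≤ n) (k : ℕ) {Y : Mat (n + 1)}
    (hY : Y ∈ spe (n + 1)) : realize k Y ∈ prolongTerm (speExt n 1 n) k :=
  realize_mem_prolongTerm (fun _ hY v => sbr_mem_spe hY.1 (lift_mem_pe v))
    (fun _ hY => realize_one_mem_speExt hn hY) k Y hY

theorem mem_spe_of_hasDegree {d : ℤ} (hd : d ≠ 0) {Y : Mat (n + 1)} (hY : Y ∈ pe (n + 1))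
    (hYd : HasDegree d Y) : Y ∈ spe (n + 1) := by
  refine ⟨hY, ?_⟩
  rw [str_eq_sum]
  refine Finset.sum_eq_zero fun a _ => ?_
  rw [hYd.apply_eq_zero (by omega), mul_zero]

/-- The term of degree `1`: the scalar parts of the values of an element form a linear functional
on `V`. Subtracting the realization of the element of `pe(n+1)` with this functional leaves an
element of the prolongation of `pe(n)`, which is zero. -/
theorem exists_realize_two {X : Tower (Idx n → ℂ) 2} (hX : X ∈ prolongTerm (cpe n) 2) :
    ∃ Y ∈ pe (n + 1), HasDegree 1 Y ∧ realize 2 Y = X := by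
  have hX' : ∀ j : Idx n, ∃ P ∈ pe n, ∃ c : ℂ,
      towerOne (towerSucc 1 X (Pi.single j 1)) = Matrix.toLin' (P + c • (1 : Mat n)) := by
    intro j
    obtain ⟨M, hM, hMX⟩ := mem_prolongTerm_one.1 (hX.1 (Pi.single j 1))
    obtain ⟨P, hP, c, rfl⟩ := mem_cpe.1 hM
    exact ⟨P, hP, c, hMX.symm⟩
  choose P hP c hc using hX'
  refine ⟨degOneMat (-c), degOneMat_mem_pe _, hasDegree_degOneMat _, ?_⟩
  have hmem : X - realize 2 (degOneMat (-c)) ∈ prolongTerm (pe n) 2 := by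
    refine mem_prolongTerm_succ_succ.2 ⟨map_mem_of_single_mem _ fun j => ?_,
      (sub_mem hX (realize_mem_prolongTerm_cpe 2 (degOneMat_mem_pe (-c)))).2⟩
    have hLL : sbr (degOneMat (-c)) (lift (Pi.single j 1)) lastE lastE = -c j := by
      rw [sbr_lift_apply]
      simp [-Fintype.sum_sum_type, degOneMat, Pi.single_apply]
    refine mem_prolongTerm_one.2
      ⟨P j - (sbr (degOneMat (-c)) (lift (Pi.single j 1))).submatrix embIdx embIdx,
        sub_mem (hP j) (submatrix_mem_pe (sbr_mem_pe (degOneMat_mem_pe _) (lift_mem_pe _))), ?_⟩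
    change _ = towerOne (towerSucc 1 (X - realize 2 (degOneMat (-c))) (Pi.single j 1))
    rw [map_sub (towerSucc 1), LinearMap.sub_apply, realize_succ_apply, map_sub towerOne, hc,
      realize_one_apply, hLL, ← map_sub]
    congr 1
    module
  rw [prolongTerm_pe_two, Submodule.mem_bot, sub_eq_zero] at hmem
  exact hmem.symm

/-- Degree `2` and above: the values of an element of the prolongation on the basis come from
homogeneous elements of `pe(n+1)`, and the supersymmetry of the element is that of
their brackets with `V`. -/
theorem exists_lifts (hn : 1 ≤ n) {k : ℕ}
    (ih : ∀ X ∈ prolongTerm (cpe n) (k + 2),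
      ∃ Y ∈ pe (n + 1), HasDegree (k + 1) Y ∧ realize (k + 2) Y = X)
    {X : Tower (Idx n → ℂ) (k + 3)} (hX : X ∈ prolongTerm (cpe n) (k + 3)) :
    ∃ Y : Idx n → Mat (n + 1), (∀ j, Y j ∈ pe (n + 1)) ∧ (∀ j, HasDegree (k + 1) (Y j)) ∧
      (∀ j, realize (k + 2) (Y j) = towerSucc (k + 2) X (Pi.single j 1)) ∧
      ∀ i j, sbr (Y i) (lift (Pi.single j 1)) =
        koszul (idxParity i) (idxParity j) • sbr (Y j) (lift (Pi.single i 1)) := by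
  choose Y hY hYd hYX using fun j => ih _ (hX.1 (Pi.single j 1))
  refine ⟨Y, hY, hYd, hYX, fun i j => sub_eq_zero.1 ?_⟩
  have hpe : ∀ i j, sbr (Y i) (lift (Pi.single j 1)) ∈ pe (n + 1) := fun i j =>
    sbr_mem_pe (hY i) (lift_mem_pe _)
  refine eq_zero_of_realize_eq_zero hn (k := k + 1)
    (sub_mem (hpe i j) (Submodule.smul_mem _ _ (hpe j i))) ?_ ?_
  · push_cast
    exact ((hYd i).sbr_lift _).sub (((hYd j).sbr_lift _).smul _)
  · rw [map_sub, map_smul, ← realize_succ_apply, ← realize_succ_apply, hYX, hYX, sub_eq_zero]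
    exact hX.2 _ _ _ (single_mem_stdParity i) _ (single_mem_stdParity j)

/-- The term of degree `2`. An element amounts to a bilinear form `Y_i(e_{n+1}, e_j)` on `V`;
if `n ≥ 2`, comparing coefficients makes it proportional to the odd form. -/
theorem exists_realize_three (hn : 2 ≤ n) {X : Tower (Idx n → ℂ) 3}
    (hX : X ∈ prolongTerm (cpe n) 3) :
    ∃ Y ∈ pe (n + 1), HasDegree 2 Y ∧ realize 3 Y = X := by
  obtain ⟨Y, hY, hYd, hYX, hs⟩ := exists_lifts (k := 0) (by omega)
    (fun X hX => by simpa using exists_realize_two hX) hX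
  simp only [Nat.cast_zero, zero_add] at hYd
  have hs' : ∀ l k i b : Idx n, _ = _ := fun l k i b =>
    congrFun₂ (hs l k) (embIdx i) (embIdx b)
  simp only [sbr_lift_apply, Matrix.smul_apply, embIdx_ne_lastE, embIdx_ne_lastF, if_false,
    swap_embIdx, extZero_embIdx, apply_embIdx_lastF (hY _), idxParity_embIdx,
    smul_eq_mul] at hs'
  -- Off the support of the odd form, compare coefficients at a basis vector `k` different from `l`
  -- and `b.swap`; it exists as `V` has dimension at least `4`.
  have hoff : ∀ l b : Idx n, b ≠ l.swap → Y l lastE (embIdx b) = 0 := by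
    intro l b hb
    obtain ⟨k, hkl, hkb⟩ : ∃ k : Idx n, k ≠ l ∧ k ≠ b.swap := by
      have : ∃ k ∉ ({l, b.swap} : Finset (Idx n)), True := by
        by_contra h
        push Not at h
        have h₁ : Finset.univ ⊆ ({l, b.swap} : Finset (Idx n)) := fun k _ => by
          by_contra hk
          exact h k hk
        have h₂ := (Finset.card_le_card h₁).trans Finset.card_le_two
        simp at h₂
        omega
      obtain ⟨k, hk, -⟩ := this
      simp only [Finset.mem_insert, Finset.mem_singleton, not_or] at hk
      exact ⟨k, hk⟩
    have h := hs' l k k b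
    have h₁ : b.swap ≠ l := fun h => hb (by rw [← h, Sum.swap_swap])
    simpa [Pi.single_apply, hkl, hkb.symm, h₁, koszul_ne_zero] using h
  -- On the support of the odd form the coefficients at two different basis vectors agree.
  have hdiag : ∀ l k : Idx n, Y l lastE (embIdx l.swap) = Y k lastE (embIdx k.swap) := by
    intro l k
    by_cases hkl : k = l
    · rw [hkl]
    have h := hs' l k k l.swap
    have hlk : l ≠ k := fun h => hkl h.symm
    simp only [Pi.single_apply, Sum.swap_swap, hkl, hlk, if_true, if_false] at h
    rcases zmod_two_cases (idxParity l) with h₁ | h₁ <;>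
      rcases zmod_two_cases (idxParity k) with h₂ | h₂ <;>
      simpa [h₁, h₂, zmod_two_one_add_one] using h
  let i₀ : Idx n := Sum.inl ⟨0, by omega⟩
  let Z : Mat (n + 1) := degTwoMat (-Y i₀ lastE (embIdx i₀.swap))
  have hZ : Z ∈ pe (n + 1) := degTwoMat_mem_pe _
  have hZd : HasDegree 2 Z := hasDegree_degTwoMat _
  refine ⟨Z, hZ, hZd, tower_ext_single fun j => ?_⟩
  rw [← hYX j, realize_succ_apply]
  congr 1
  refine sub_eq_zero.1 (eq_zero_of_hasDegree_one
    (sub_mem (sbr_mem_pe hZ (lift_mem_pe _)) (hY j)) ((hZd.sbr_lift _).sub (hYd j)) fun b => ?_)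
  rw [Matrix.sub_apply, sbr_lift_apply]
  by_cases hb : b = j.swap
  · subst hb
    simp [Z, degTwoMat, hdiag j i₀]
  · have h₁ : b.swap ≠ j := fun h => hb (by rw [← h, Sum.swap_swap])
    simp [Z, degTwoMat, hoff j b hb, h₁]

/-- In degree `3` an element amounts to scalars `λ_j`, with `λ_j E_{e_{n+1}, f_{n+1}}` the value at
the `j`-th basis vector; supersymmetry at `j` and any `k ≠ j` gives `λ_j = 0`. -/
theorem prolongTerm_cpe_four (hn : 2 ≤ n) : prolongTerm (cpe n) 4 = ⊥ := by
  refine (Submodule.eq_bot_iff _).2 fun X hX => ?_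
  obtain ⟨Y, hY, hYd, hYX, hs⟩ := exists_lifts (k := 1) (by omega)
    (fun X hX => exists_realize_three hn hX) hX
  refine tower_ext_single fun j => ?_
  suffices Y j = 0 by rw [← hYX j, this]; simp
  refine eq_zero_of_hasDegree_two (by simpa using hYd j) ?_
  obtain ⟨k, hk⟩ : ∃ k : Idx n, k ≠ j := by
    rcases j with j | j
    exacts [⟨Sum.inr j, by simp⟩, ⟨Sum.inl j, by simp⟩]
  have h := congrFun₂ (hs j k) lastE (embIdx k.swap)
  simpa [sbr_lift_apply, hk, Pi.single_apply] using h

/-- In degree at least `1`, the prolongation of `cpe(n)` is the realization of `pe(n+1)`. -/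
theorem exists_realize_of_two_le (hn : 2 ≤ n) {k : ℕ} (hk : 2 ≤ k) {X : Tower (Idx n → ℂ) k}
    (hX : X ∈ prolongTerm (cpe n) k) :
    ∃ Y ∈ pe (n + 1), HasDegree (k - 1) Y ∧ realize k Y = X := by
  obtain rfl | rfl | h : k = 2 ∨ k = 3 ∨ 4 ≤ k := by omega
  · simpa using exists_realize_two hX
  · exact exists_realize_three hn hX
  · rw [prolongTerm_eq_bot_of_le (by norm_num) (prolongTerm_cpe_four hn) h, Submodule.mem_bot] at hX
    exact ⟨0, zero_mem _, fun a b h => absurd rfl h, by rw [hX, map_zero]⟩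

/-! ### Vanishing of the prolongations of the other subalgebras -/

theorem mem_pe_of_mem_speExt (hn : 1 ≤ n) {a b : ℂ} (hab : b ≠ n * a) {M : Mat n}
    (h : M ∈ speExt n 1 n) (h' : M ∈ speExt n a b) : M ∈ pe n := by
  obtain ⟨P, hP, t, rfl⟩ := mem_speExt.1 h
  obtain ⟨Q, hQ, t', hM⟩ := mem_speExt.1 h'
  have hone : str (1 : Mat n) = 0 := by simp [str_eq_sum]
  have hn' : (n : ℂ) ≠ 0 := by exact_mod_cast (by omega : n ≠ 0)
  -- The supertrace compares the coefficients of `τ`,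
  have hs := congrArg str hM
  simp only [str_add, str_smul, hP.2, hQ.2, str_tau, hone] at hs
  have ht : t = t' * a := by
    apply mul_right_cancel₀ hn'
    linear_combination -hs / 2
  -- and the trace those of `z`.
  have htr : ∀ R ∈ pe n, Matrix.trace R = 0 := fun R hR => by
    have e : ∀ i, R (Sum.inr i) (Sum.inr i) = -R (Sum.inl i) (Sum.inl i) := fun i =>
      congrFun₂ hR.1 i i
    simp [Matrix.trace, e]
  have hz := congrArg Matrix.trace hM
  simp only [Matrix.trace_add, Matrix.trace_smul, htr P hP.1, htr Q hQ.1, htr _ tau_mem_pe,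
    smul_eq_mul, mul_zero, zero_add, Matrix.trace_one, Fintype.card_sum, Fintype.card_fin] at hz
  push_cast at hz
  have h₂ : t' * (b - n * a) = 0 := by
    rw [ht] at hz
    have : (t' * (b - n * a)) * n = 0 := by linear_combination hz / 2
    exact (mul_eq_zero.1 this).resolve_right hn'
  have ht' : t' = 0 := (mul_eq_zero.1 h₂).resolve_right (sub_ne_zero.2 hab)
  rw [ht, ht', zero_mul, zero_smul, add_zero]
  exact hP.1

/-- The values of an element of degree `1` lie in `spe(n) ⊕ ⟨τ + nz⟩`, as those of
`[pe(n+1), pe(n+1)] ⊆ spe(n+1)` do. -/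
theorem prolongTerm_speExt_two (hn : 1 ≤ n) {a b : ℂ} (hab : b ≠ n * a) :
    prolongTerm (speExt n a b) 2 = ⊥ := by
  refine (Submodule.eq_bot_iff _).2 fun X hX => ?_
  have hX' : X ∈ prolongTerm (speExt n 1 n) 2 := by
    obtain ⟨Y, hY, hYd, rfl⟩ := exists_realize_two (prolongTerm_mono (speExt_le_cpe a b) 2 hX)
    exact realize_mem_prolongTerm_speExt hn 2 (mem_spe_of_hasDegree one_ne_zero hY hYd)
  rw [← Submodule.mem_bot ℂ, ← prolongTerm_pe_two]
  refine mem_prolongTerm_succ_succ.2 ⟨fun v => ?_, hX.2⟩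
  obtain ⟨M, hM, hMX⟩ := mem_prolongTerm_one.1 (hX.1 v)
  obtain ⟨M', hM', hMX'⟩ := mem_prolongTerm_one.1 (hX'.1 v)
  obtain rfl : M' = M := Matrix.toLin'.injective (hMX'.trans hMX.symm)
  exact mem_prolongTerm_one.2 ⟨M', mem_pe_of_mem_speExt hn hab hM' hM, hMX⟩

/-! ### The isomorphisms of graded Lie superalgebras -/

/-- A subalgebra of `pe(n+1)` containing the part of degree `-1` is isomorphic to the
prolongation of `g` as soon as each term of the latter is realized in it. -/
theorem exists_isGradedIso (hn : 1 ≤ n) {L : Submodule ℂ (Mat (n + 1))} {g : Submodule ℂ (Mat n)}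
    (hL : L ≤ pe (n + 1)) (hcl : ∀ X ∈ L, ∀ Y ∈ L, sbr X Y ∈ L)
    (hmem : ∀ k, ∀ Y ∈ L, realize k Y ∈ prolongTerm g k)
    (hsurj : ∀ k, ∀ X ∈ prolongTerm g k, ∃ Y ∈ L, HasDegree (k - 1) Y ∧ realize k Y = X) :
    ∃ φ : L ≃ₗ[ℂ] prolong g, IsGradedIso L g φ := by
  let f : L →ₗ[ℂ] prolong g := LinearMap.codRestrict (prolong g)
    (LinearMap.pi (fun k => realize k) ∘ₗ L.subtype) fun Y => by
      refine ⟨fun k => hmem k Y Y.2, 4, fun k hk => ?_⟩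
      change realize k (Y : Mat (n + 1)) = 0
      rw [← realize_degPart, degPart_eq_zero, map_zero]
      rw [Finset.mem_Icc]
      omega
  have hf : ∀ (Y : L) (k : ℕ), (f Y : Fields (Idx n → ℂ)) k = realize k (Y : Mat (n + 1)) :=
    fun _ _ => rfl
  have hinj : Function.Injective f := by
    refine (injective_iff_map_eq_zero f).2 fun Y hY => Subtype.ext ?_
    refine eq_zero_of_forall_realize_eq_zero hn (hL Y.2) fun k => ?_
    rw [← hf, hY]
    rfl
  have hsur : Function.Surjective f := by
    rintro ⟨X, hX, N, hN⟩
    choose Y hY hYd hYX using fun k => hsurj k (X k) (hX k)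
    refine ⟨⟨∑ k ∈ Finset.range N, Y k, Submodule.sum_mem _ fun k _ => hY k⟩, Subtype.ext ?_⟩
    ext k : 1
    rw [hf]
    change realize k (∑ k ∈ Finset.range N, Y k) = X k
    rw [map_sum]
    have hne : ∀ l, l ≠ k → realize k (Y l) = 0 := fun l hl =>
      realize_eq_zero_of_hasDegree (hYd l) (by omega)
    by_cases hk : k < N
    · rw [Finset.sum_eq_single_of_mem k (Finset.mem_range.2 hk) fun l _ hl => hne l hl, hYX]
    · rw [hN k (not_lt.1 hk)]
      refine Finset.sum_eq_zero fun l hl => hne l ?_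
      rintro rfl
      exact hk (Finset.mem_range.1 hl)
  refine ⟨LinearEquiv.ofBijective f ⟨hinj, hsur⟩, ?_, ?_, ?_, ?_⟩
  · exact fun p x hx k => realize_mem_towerParity hx k
  · exact fun d x hx k hk => realize_eq_zero_of_hasDegree hx hk
  · intro p q x y hx hy
    refine ⟨sbr_eq_superComm hx hy ▸ hcl x x.2 y y.2, funext fun k => ?_⟩
    change realize k (superComm p q (x : Mat (n + 1)) y) = _
    rw [← sbr_eq_superComm hx hy, realize_superComm (hL x.2) (hL y.2) hx hy]
    rfl
  · exact fun x i _ => realize_zero_apply _ i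

theorem exists_realize_zero (X : Tower (Idx n → ℂ) 0) :
    ∃ Y ∈ spe (n + 1), HasDegree (-1) Y ∧ realize 0 Y = X :=
  ⟨lift (towerZero X), lift_mem_spe _, hasDegree_lift _,
    towerZero.injective (realize_lift_zero _)⟩

theorem exists_realize_one_cpe {X : Tower (Idx n → ℂ) 1} (hX : X ∈ prolongTerm (cpe n) 1) :
    ∃ Y ∈ pe (n + 1), HasDegree 0 Y ∧ realize 1 Y = X := by
  obtain ⟨M, hM, hMX⟩ := mem_prolongTerm_one.1 hX
  obtain ⟨P, hP, c, rfl⟩ := mem_cpe.1 hM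
  refine ⟨degZeroMat P (-c), degZeroMat_mem_pe hP _, hasDegree_degZeroMat _ _,
    towerOne.injective ?_⟩
  rw [realize_one_degZeroMat, ← hMX]
  congr 1
  module

theorem exists_realize_one_speExt {X : Tower (Idx n → ℂ) 1}
    (hX : X ∈ prolongTerm (speExt n 1 n) 1) :
    ∃ Y ∈ spe (n + 1), HasDegree 0 Y ∧ realize 1 Y = X := by
  obtain ⟨M, hM, hMX⟩ := mem_prolongTerm_one.1 hX
  obtain ⟨P, hP, c, rfl⟩ := mem_speExt.1 hM
  have hP' : P + c • tau n ∈ pe n := add_mem hP.1 (Submodule.smul_mem _ _ tau_mem_pe)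
  have hY := degZeroMat_mem_pe hP' (-(c * n))
  refine ⟨degZeroMat (P + c • tau n) (-(c * n)), ⟨hY, ?_⟩, hasDegree_degZeroMat _ _,
    towerOne.injective ?_⟩
  · have h := str_submatrix hY
    have hsub : (degZeroMat (P + c • tau n) (-(c * n))).submatrix embIdx embIdx =
        P + c • tau n := by
      ext i j
      simp [degZeroMat]
    have hLL : degZeroMat (P + c • tau n) (-(c * n)) lastE lastE = -(c * n) := by
      simp [degZeroMat]
    rw [hsub, hLL, str_add, str_smul, hP.2, str_tau] at h
    linear_combination -h
  · rw [realize_one_degZeroMat, ← hMX]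
    congr 1
    module

theorem exists_isGradedIso_cpe (hn : 2 ≤ n) :
    ∃ φ : pe (n + 1) ≃ₗ[ℂ] prolong (cpe n), IsGradedIso (pe (n + 1)) (cpe n) φ := by
  refine exists_isGradedIso (by omega) le_rfl (fun X hX Y hY => sbr_mem_pe hX hY)
    (fun k Y hY => realize_mem_prolongTerm_cpe k hY) fun k X hX => ?_
  obtain rfl | rfl | hk : k = 0 ∨ k = 1 ∨ 2 ≤ k := by omega
  · obtain ⟨Y, hY, h⟩ := exists_realize_zero X
    exact ⟨Y, hY.1, by simpa using h⟩
  · simpa using exists_realize_one_cpe hX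
  · exact exists_realize_of_two_le hn hk hX

theorem exists_isGradedIso_speExt (hn : 2 ≤ n) :
    ∃ φ : spe (n + 1) ≃ₗ[ℂ] prolong (speExt n 1 n),
      IsGradedIso (spe (n + 1)) (speExt n 1 n) φ := by
  refine exists_isGradedIso (by omega) (fun X hX => hX.1)
    (fun X hX Y hY => sbr_mem_spe hX.1 hY.1)
    (fun k Y hY => realize_mem_prolongTerm_speExt (by omega) k hY) fun k X hX => ?_
  obtain rfl | rfl | hk : k = 0 ∨ k = 1 ∨ 2 ≤ k := by omega
  · simpa using exists_realize_zero X
  · simpa using exists_realize_one_speExt hX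
  · obtain ⟨Y, hY, hYd, h⟩ := exists_realize_of_two_le hn hk
      (prolongTerm_mono (speExt_le_cpe _ _) k hX)
    exact ⟨Y, mem_spe_of_hasDegree (by omega) hY hYd, hYd, h⟩

end Periplectic

end

open Periplectic

theorem mainTheorem2 (n : ℕ) (hn : 1 ≤ n) :
    (∀ k, 2 ≤ k → prolongTerm (spe n) k = ⊥) ∧
    (∀ k, 2 ≤ k → prolongTerm (pe n) k = ⊥) ∧
    (∀ k, 2 ≤ k → prolongTerm (cspe n) k = ⊥) ∧
    (∀ a b : ℂ, a ≠ 0 → b ≠ 0 → b / a ≠ n → ∀ k, 2 ≤ k → prolongTerm (speExt n a b) k = ⊥) ∧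
    (2 ≤ n → (∃ φ : pe (n + 1) ≃ₗ[ℂ] prolong (cpe n), IsGradedIso (pe (n + 1)) (cpe n) φ) ∧
      ∃ φ : spe (n + 1) ≃ₗ[ℂ] prolong (speExt n 1 n),
        IsGradedIso (spe (n + 1)) (speExt n 1 n) φ) := by
  have hpe : ∀ k, 2 ≤ k → prolongTerm (pe n) k = ⊥ := fun k hk =>
    prolongTerm_eq_bot_of_le one_le_two prolongTerm_pe_two hk
  refine ⟨fun k hk => ?_, hpe, fun k hk => ?_, fun a b ha _ hab k hk => ?_,
    fun hn => ⟨exists_isGradedIso_cpe hn, exists_isGradedIso_speExt hn⟩⟩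
  · exact eq_bot_mono (prolongTerm_mono (fun X (hX : X ∈ spe n) => hX.1) k) (hpe k hk)
  · rw [cspe_eq_speExt]
    exact prolongTerm_eq_bot_of_le one_le_two (prolongTerm_speExt_two hn (by simp)) hk
  · refine prolongTerm_eq_bot_of_le one_le_two (prolongTerm_speExt_two hn fun h => hab ?_) hk
    rw [h, mul_div_cancel_right₀ _ ha]
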